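/- Let $\mathbf A=(A_1,A_2)\in C^\infty(\mathbb R^2;\mathbb C^2)$ and $\mathbf B=\partial_{x_1}A_2-\partial_{x_2}A_1$. For $h>0$ let $$\mathrm{Dom}(Q_{h,\mathbf A})=\{u\in L^2(\mathbb R^2):\ (-ih\nabla-\Re\mathbf A)u\in L^2,\ (\Im\mathbf A)u\in L^2\},\qquad Q_{h,\mathbf A}(u,v)=\int_{\mathbb R^2}(-ih\nabla-\mathbf A)u\cdot\overline{(-ih\nabla-\overline{\mathbf A})v}\,dx ,$$ with derivatives in the sense of distributions, and let the magnetic Laplacian $\mathscr L_{h,\mathbf A}=(-ih\nabla-\mathbf A)^2$ be the operator in $L^2(\mathbb R^2)$ with domain $$\mathrm{Dom}(\mathscr L_{h,\mathbf A})=\{u\in\mathrm{Dom}(Q_{h,\mathbf A}):\ \exists f\in L^2(\mathbb R^2)\ \forall v\in\mathrm{Dom}(Q_{h,\mathbf A}),\ Q_{h,\mathbf A}(u,v)=\langle f,v\rangle\},\qquad \mathscr L_{h,\mathbf A}u=f .$$ (If $\Im\mathbf A$ is form-bounded with respect to $-ih\nabla-\Re\mathbf A$ with relative bound less than $1$, this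 is an m-sectorial operator; the result below does not need that condition.) With $\partial_z=\frac12(\partial_{x_1}-i\partial_{x_2})$ and $\partial_{\bar z}=\frac12(\partial_{x_1}+i\partial_{x_2})$, put, where $\partial_{\bar z}\mathbf B\ne0$, $$Q_1=\tfrac14\Re\Big[\mathbf B\Big(1+\frac{\partial_z\mathbf B}{\partial_{\bar z}\mathbf B}\Big)\Big]+\tfrac12\partial_{x_1}\Im A_1,\quad Q_2=\tfrac14\Im\Big[\mathbf B\,\frac{\partial_z\mathbf B}{\partial_{\bar z}\mathbf B}\Big]+\tfrac14\big(\partial_{x_1}\Im A_2+\partial_{x_2}\Im A_1\big),\quad Q_3=\tfrac14\Re\Big[\mathbf B\Big(1-\frac{\partial_z\mathbf B}{\partial_{\bar z}\mathbf B}\Big)\Big]+\tfrac12\partial_{x_2}\Im A_2,$$ and let $\Gamma$ be the set of all $x\in\mathbb R^2$ such that $\Im\mathbf A(x)=0$, $\mathbf B(x)\neq0$, $\partial_{\bar z}\mathbf B(x)\ne0$, $Q_1(x)>0$ and $Q_1(x)Q_3(x)-Q_2(x)^2>0$. (a) Let $x^0\in\Gamma$ and assume that $\mathbf B$ is real-analytic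 at $x^0$. Then there are constants $C,h_0>0$ and a family of functions $u_h\in C_c^\infty(\mathbb R^2)\setminus\{0\}$, $0<h\le h_0$, such that $u_h\in\mathrm{Dom}(\mathscr L_{h,\mathbf A})$ and $$\big\|(\mathscr L_{h,\mathbf A}-h\mathbf B(x^0))u_h\big\|\le\exp\Big(-\frac{C}{h^{1/7}}\Big)\|u_h\|\qquad\text{for all }h\in(0,h_0],$$ where $\|\cdot\|$ is the norm of $L^2(\mathbb R^2)$. (b) If $\Im\mathbf A=0$ on $\mathbb R^2$, then $\Gamma=\varnothing$. -/

import Mathlib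

open MeasureTheory Set
open scoped ContDiff ComplexConjugate

noncomputable section

/-- The plane `ℝ²` with its Euclidean norm and Lebesgue measure. -/
abbrev Plane : Type := EuclideanSpace ℝ (Fin 2)

/-- The Hilbert space `L²(ℝ²; ℂ)`. -/
abbrev PlaneL2 : Type := Lp ℂ 2 (volume : Measure Plane)

/-- The `j`-th vector of the canonical basis of `ℝ²` (index `0` stands for `x₁`, `1` for `x₂`). -/
def basisVec (j : Fin 2) : Plane := EuclideanSpace.single j 1

/-- The (classical) partial derivative `∂_{x_j} f`. -/
def partialDeriv {F : Type*} [NormedAddCommGroup F] [NormedSpace ℝ F]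
    (j : Fin 2) (f : Plane → F) (x : Plane) : F :=
  fderiv ℝ f x (basisVec j)

/-- `φ ∈ C_c^∞(ℝ²; ℂ)`. -/
def IsTestFunction (φ : Plane → ℂ) : Prop :=
  ContDiff ℝ ∞ φ ∧ HasCompactSupport φ

theorem IsTestFunction.memLp {φ : Plane → ℂ} (hφ : IsTestFunction φ) :
    MemLp φ 2 (volume : Measure Plane) :=
  hφ.1.continuous.memLp_of_hasCompactSupport hφ.2

/-- A test function, seen as an element of `L²(ℝ²)`. -/
def IsTestFunction.toL2 {φ : Plane → ℂ} (hφ : IsTestFunction φ) : PlaneL2 :=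
  hφ.memLp.toLp φ

/-! ### The magnetic Laplacian -/

/-- `g = (-ih∇ - Re A) u` in the sense of distributions, with `u ∈ L²` and `g ∈ L² × L²`:
for all test functions `φ`, `∫ g_j φ = ∫ u (ih ∂_j φ - (Re A_j) φ)`. -/
def IsMagneticGradient (h : ℝ) (A : Plane → Fin 2 → ℂ) (u : PlaneL2) (g : Fin 2 → PlaneL2) :
    Prop :=
  ∀ j, ∀ φ : Plane → ℂ, IsTestFunction φ →
    ∫ x, g j x * φ x =
      ∫ x, u x * (Complex.I * (h : ℂ) * partialDeriv j φ x - ((A x j).re : ℂ) * φ x)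

/-- `Dom(Q_{h,A})`: the `u ∈ L²` with `(-ih∇ - Re A) u ∈ L²` and `(Im A) u ∈ L²`. -/
def formDomain (h : ℝ) (A : Plane → Fin 2 → ℂ) : Set PlaneL2 :=
  {u | (∃ g, IsMagneticGradient h A u g) ∧
    ∀ j, MemLp (fun x => ((A x j).im : ℂ) * u x) 2 (volume : Measure Plane)}

open Classical in
/-- `(-ih∇ - Re A) u` as an element of `L² × L²` (with the value `0` if it is not in `L²`). -/
def magneticGradient (h : ℝ) (A : Plane → Fin 2 → ℂ) (u : PlaneL2) : Fin 2 → PlaneL2 :=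
  if hu : ∃ g, IsMagneticGradient h A u g then hu.choose else 0

/-- The form `Q_{h,A}(u,v) = ∫ (-ih∇ - A)u · conj((-ih∇ - conj A)v)`, where
`-ih∇ - A = (-ih∇ - Re A) - i Im A` and `-ih∇ - conj A = (-ih∇ - Re A) + i Im A`. -/
def magneticForm (h : ℝ) (A : Plane → Fin 2 → ℂ) (u v : PlaneL2) : ℂ :=
  ∑ j, ∫ x, (magneticGradient h A u j x - Complex.I * ((A x j).im : ℂ) * u x) *
    conj (magneticGradient h A v j x + Complex.I * ((A x j).im : ℂ) * v x)

/-- `u` is in the domain of `ℒ_{h,A}` and `ℒ_{h,A} u = f`: `u ∈ Dom(Q_{h,A})` and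
`Q_{h,A}(u,v) = ⟨f,v⟩` for all `v ∈ Dom(Q_{h,A})`. -/
def IsMagneticLaplacian (h : ℝ) (A : Plane → Fin 2 → ℂ) (u f : PlaneL2) : Prop :=
  u ∈ formDomain h A ∧
    ∀ v ∈ formDomain h A, magneticForm h A u v = ∫ x, f x * conj (v x)

/-- `Dom(ℒ_{h,A})`. -/
def magneticDomain (h : ℝ) (A : Plane → Fin 2 → ℂ) : Set PlaneL2 :=
  {u | ∃ f, IsMagneticLaplacian h A u f}

open Classical in
/-- The magnetic Laplacian `ℒ_{h,A}` on its domain (with the value `0` outside of it). -/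
def magneticLaplacian (h : ℝ) (A : Plane → Fin 2 → ℂ) (u : PlaneL2) : PlaneL2 :=
  if hu : ∃ f, IsMagneticLaplacian h A u f then hu.choose else 0

/-! #### The choices above are unambiguous -/

/-- An element of `L²` is determined by its integrals against test functions. -/
theorem planeL2_ext {f g : PlaneL2}
    (hfg : ∀ φ : Plane → ℂ, IsTestFunction φ → ∫ x, f x * φ x = ∫ x, g x * φ x) : f = g := by
  apply Lp.ext
  apply ae_eq_of_integral_contDiff_smul_eq
  · exact (Lp.memLp f).locallyIntegrable (by norm_num)
  · exact (Lp.memLp g).locallyIntegrable (by norm_num)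
  · intro φ hφ hc
    have := hfg (fun x => (φ x : ℂ))
      ⟨Complex.ofRealCLM.contDiff.comp hφ, hc.comp_left (g := fun r : ℝ => (r : ℂ)) (by simp)⟩
    simpa [mul_comm] using this

theorem magneticGradient_eq {h : ℝ} {A : Plane → Fin 2 → ℂ} {u : PlaneL2} {g : Fin 2 → PlaneL2}
    (hg : IsMagneticGradient h A u g) : magneticGradient h A u = g := by
  have hu : ∃ g, IsMagneticGradient h A u g := ⟨g, hg⟩
  have hc : IsMagneticGradient h A u (magneticGradient h A u) := by
    rw [magneticGradient, dif_pos hu]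
    exact hu.choose_spec
  funext j
  exact planeL2_ext fun φ hφ => (hc j φ hφ).trans (hg j φ hφ).symm

/-- If `A` is continuous, then `C_c^∞(ℝ²) ⊆ Dom(Q_{h,A})`. -/
theorem IsTestFunction.mem_formDomain (h : ℝ) {A : Plane → Fin 2 → ℂ} (hA : Continuous A)
    {χ : Plane → ℂ} (hχ : IsTestFunction χ) : hχ.toL2 ∈ formDomain h A := by
  have hae : (hχ.toL2 : Plane → ℂ) =ᵐ[volume] χ := hχ.memLp.coeFn_toLp
  have hAj : ∀ j, Continuous fun x => A x j := fun j => (continuous_apply j).comp hA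
  have hd : ∀ (φ : Plane → ℂ), IsTestFunction φ → ∀ j, Continuous (partialDeriv j φ) := by
    intro φ hφ j
    exact (hφ.1.continuous_fderiv (by simp)).clm_apply continuous_const
  have hdc : ∀ (φ : Plane → ℂ), IsTestFunction φ → ∀ j, HasCompactSupport (partialDeriv j φ) := by
    intro φ hφ j
    exact hφ.2.fderiv_apply (𝕜 := ℝ) (basisVec j)
  constructor
  · have hm : ∀ j, MemLp (fun x => -(Complex.I * (h : ℂ)) * partialDeriv j χ x
        - ((A x j).re : ℂ) * χ x) 2 (volume : Measure Plane) := by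
      intro j
      apply Continuous.memLp_of_hasCompactSupport
      · exact (continuous_const.mul (hd χ hχ j)).sub
          ((Complex.continuous_ofReal.comp (Complex.continuous_re.comp (hAj j))).mul
            hχ.1.continuous)
      · exact ((hdc χ hχ j).mul_left).sub (hχ.2.mul_left)
    refine ⟨fun j => (hm j).toLp _, fun j φ hφ => ?_⟩
    have e1 : ∫ x, ((hm j).toLp _ : PlaneL2) x * φ x =
        ∫ x, (-(Complex.I * (h : ℂ)) * partialDeriv j χ x - ((A x j).re : ℂ) * χ x) * φ x := by
      apply integral_congr_ae
      filter_upwards [(hm j).coeFn_toLp] with x hx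
      rw [hx]
    have e2 : ∫ x, (hχ.toL2 : Plane → ℂ) x *
          (Complex.I * (h : ℂ) * partialDeriv j φ x - ((A x j).re : ℂ) * φ x) =
        ∫ x, χ x * (Complex.I * (h : ℂ) * partialDeriv j φ x - ((A x j).re : ℂ) * φ x) := by
      apply integral_congr_ae
      filter_upwards [hae] with x hx
      rw [hx]
    rw [e1, e2]
    have i1 : Integrable (fun x => partialDeriv j χ x * φ x) (volume : Measure Plane) :=
      ((hd χ hχ j).mul hφ.1.continuous).integrable_of_hasCompactSupport (hφ.2.mul_left)
    have i2 : Integrable (fun x => χ x * partialDeriv j φ x) (volume : Measure Plane) :=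
      (hχ.1.continuous.mul (hd φ hφ j)).integrable_of_hasCompactSupport (hχ.2.mul_right)
    have i3 : Integrable (fun x => χ x * φ x) (volume : Measure Plane) :=
      (hχ.1.continuous.mul hφ.1.continuous).integrable_of_hasCompactSupport (hχ.2.mul_right)
    have i4 : Integrable (fun x => ((A x j).re : ℂ) * (χ x * φ x)) (volume : Measure Plane) :=
      ((Complex.continuous_ofReal.comp (Complex.continuous_re.comp (hAj j))).mul
        (hχ.1.continuous.mul hφ.1.continuous)).integrable_of_hasCompactSupport
          ((hχ.2.mul_right).mul_left)
    have ibp : ∫ x, χ x * partialDeriv j φ x = -∫ x, partialDeriv j χ x * φ x :=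
      integral_mul_fderiv_eq_neg_fderiv_mul_of_integrable i1 i2 i3
        (fun x _ => hχ.1.differentiable (by simp) x) (fun x _ => hφ.1.differentiable (by simp) x)
    have l : ∀ x, (-(Complex.I * (h : ℂ)) * partialDeriv j χ x - ((A x j).re : ℂ) * χ x) * φ x =
        -(Complex.I * (h : ℂ)) * (partialDeriv j χ x * φ x) -
          ((A x j).re : ℂ) * (χ x * φ x) := fun x => by ring
    have r : ∀ x, χ x * (Complex.I * (h : ℂ) * partialDeriv j φ x - ((A x j).re : ℂ) * φ x) =
        (Complex.I * (h : ℂ)) * (χ x * partialDeriv j φ x) -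
          ((A x j).re : ℂ) * (χ x * φ x) := fun x => by ring
    simp_rw [l, r]
    rw [integral_sub (i1.const_mul _) i4, integral_sub (i2.const_mul _) i4,
      integral_const_mul, integral_const_mul, ibp]
    ring
  · intro j
    have hm : MemLp (fun x => ((A x j).im : ℂ) * χ x) 2 (volume : Measure Plane) := by
      apply Continuous.memLp_of_hasCompactSupport
      · exact (Complex.continuous_ofReal.comp (Complex.continuous_im.comp (hAj j))).mul
          hχ.1.continuous
      · exact hχ.2.mul_left
    refine hm.ae_eq ?_
    filter_upwards [hae] with x hx
    rw [hx]

/-- If `A` is continuous, the value `ℒ_{h,A} u` is determined by its defining property. -/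
theorem magneticLaplacian_eq {h : ℝ} {A : Plane → Fin 2 → ℂ} (hA : Continuous A)
    {u f : PlaneL2} (hf : IsMagneticLaplacian h A u f) : magneticLaplacian h A u = f := by
  have hu : ∃ f, IsMagneticLaplacian h A u f := ⟨f, hf⟩
  have hc : IsMagneticLaplacian h A u (magneticLaplacian h A u) := by
    rw [magneticLaplacian, dif_pos hu]
    exact hu.choose_spec
  apply planeL2_ext
  intro φ hφ
  have hψ : IsTestFunction (fun x => conj (φ x)) :=
    ⟨Complex.conjCLE.contDiff.comp hφ.1, hφ.2.comp_left (g := fun z : ℂ => conj z) (by simp)⟩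
  have key := (hc.2 _ (hψ.mem_formDomain h hA)).symm.trans (hf.2 _ (hψ.mem_formDomain h hA))
  have e : ∀ g : PlaneL2, ∫ x, g x * conj ((hψ.toL2 : Plane → ℂ) x) = ∫ x, g x * φ x := by
    intro g
    apply integral_congr_ae
    filter_upwards [hψ.memLp.coeFn_toLp] with x hx
    change g x * conj ((hψ.memLp.toLp _ : PlaneL2) x) = _
    rw [hx]
    simp
  rwa [e, e] at key

/-! ### The magnetic field and the set `Γ` -/

/-- The magnetic field `B = ∂_{x₁} A₂ - ∂_{x₂} A₁`. -/
def magneticField (A : Plane → Fin 2 → ℂ) (x : Plane) : ℂ :=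
  partialDeriv 0 (fun y => A y 1) x - partialDeriv 1 (fun y => A y 0) x

/-- The Wirtinger derivative `∂_z = (∂_{x₁} - i ∂_{x₂}) / 2`. -/
def wirtinger (f : Plane → ℂ) (x : Plane) : ℂ :=
  (1 / 2) * (partialDeriv 0 f x - Complex.I * partialDeriv 1 f x)

/-- The Wirtinger derivative `∂_{z̄} = (∂_{x₁} + i ∂_{x₂}) / 2`. -/
def wirtingerBar (f : Plane → ℂ) (x : Plane) : ℂ :=
  (1 / 2) * (partialDeriv 0 f x + Complex.I * partialDeriv 1 f x)

/-- The quotient `∂_z B / ∂_{z̄} B`, only used where `∂_{z̄} B ≠ 0`. -/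
def fieldRatio (A : Plane → Fin 2 → ℂ) (x : Plane) : ℂ :=
  wirtinger (magneticField A) x / wirtingerBar (magneticField A) x

/-- The function `Q₁`. -/
def formQ1 (A : Plane → Fin 2 → ℂ) (x : Plane) : ℝ :=
  (1 / 4) * (magneticField A x * (1 + fieldRatio A x)).re +
    (1 / 2) * partialDeriv 0 (fun y => (A y 0).im) x

/-- The function `Q₂`. -/
def formQ2 (A : Plane → Fin 2 → ℂ) (x : Plane) : ℝ :=
  (1 / 4) * (magneticField A x * fieldRatio A x).im +
    (1 / 4) * (partialDeriv 0 (fun y => (A y 1).im) x + partialDeriv 1 (fun y => (A y 0).im) x)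

/-- The function `Q₃`. -/
def formQ3 (A : Plane → Fin 2 → ℂ) (x : Plane) : ℝ :=
  (1 / 4) * (magneticField A x * (1 - fieldRatio A x)).re +
    (1 / 2) * partialDeriv 1 (fun y => (A y 1).im) x

/-- The set `Γ`. -/
def gammaSet (A : Plane → Fin 2 → ℂ) : Set Plane :=
  {x | (∀ j, (A x j).im = 0) ∧ magneticField A x ≠ 0 ∧ wirtingerBar (magneticField A) x ≠ 0 ∧
    0 < formQ1 A x ∧ 0 < formQ1 A x * formQ3 A x - formQ2 A x ^ 2}

end

/-!
Write `P_j = -ih∂_j - A_j`. The statement does not prescribe where the quasimodes concentrate, and it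
is simplest to place them at a point `x₁` close to `x₀` where `Im A ≠ 0`. Such points exist: if
`Im A` vanished near `x₀`, then `B` would be real there, `|∂_z B| = |∂_{z̄} B|`, and the discriminant
`Q₁Q₃ - Q₂²` would be `0` (`formQ_discriminant_eq_zero`, which also gives the second part of the
theorem). Moreover `Q₁ + Q₃ > 0` on `Γ`, that is, `Re B + div Im A > 0`, and this persists at `x₁`.
At such a point every number `hμ` is an approximate eigenvalue, with an error exponentially small
in `1 / h` (`exists_quasimode`); this applies in particular to `μ = B(x₀)`.

To see this, continue `B` to a holomorphic function of `(z, ζ)` near `ζ = z̄`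
(`AnalyticAt.exists_complexification`) and choose a holomorphic `w` with `∂_ζ w = -iB`. Then
`A - (w / 2) (1, i)` is closed, hence equal to `∇f` near `x₁`, and, as `1² + i² = 0`,
`e^{-if/h} (P₁² + P₂²) e^{if/h} v = h (-4h ∂_z∂_ζ v + 2iw ∂_ζ v + B v)`
for `v = v(z, ζ)` (`classicalLaplacian_wkb`). The function `w` is free up to a holomorphic function
of `z`; its value and its first derivative at `x₁` are used to give `Im f` a critical point at `x₁`
with Hessian a positive multiple of the identity (`exists_phase`), so that `e^{if/h}` decays like a
Gaussian. The value is `w(x₁) = 2 (Im A₂ + i Im A₁)(x₁)`, which is not `0`: this is where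
`Im A(x₁) ≠ 0` enters.

Since `w ≠ 0`, the equation `-4h ∂_z∂_ζ v + 2iw ∂_ζ v + (B - μ) v = 0` is a non-degenerate transport
equation for `y = ∂_ζ v`, perturbed by `h ∂_z y`. It is solved by iteration. By Cauchy's estimates,
each step gains a factor `1 / 2` on bidiscs with slowly decreasing radii as long as the number
of steps is at most a small multiple of `1 / h`, and the remainder is `O(e^{-c/h})`
(`exists_amplitude`). The quasimode is `χ e^{if/h} v` with a cutoff function `χ`; the terms
containing derivatives of `χ` live away from `x₁` and are exponentially small too.
-/

/-! ### Holomorphic functions on a bidisc and their primitives in the second variable -/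

/-- The dilation `(z, ζ) ↦ (z, tζ)` of `ℂ²`. -/
noncomputable def scaleSnd (t : ℝ) : ℂ × ℂ →L[ℂ] ℂ × ℂ :=
  (ContinuousLinearMap.fst ℂ ℂ ℂ).prod ((t : ℂ) • ContinuousLinearMap.snd ℂ ℂ ℂ)

@[simp]
theorem scaleSnd_apply (t : ℝ) (p : ℂ × ℂ) : scaleSnd t p = (p.1, (t : ℂ) * p.2) := rfl

theorem continuous_scaleSnd : Continuous scaleSnd := by
  have : scaleSnd = fun t : ℝ =>
      (ContinuousLinearMap.inl ℂ ℂ ℂ).comp (ContinuousLinearMap.fst ℂ ℂ ℂ) +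
      (t : ℂ) • (ContinuousLinearMap.inr ℂ ℂ ℂ).comp (ContinuousLinearMap.snd ℂ ℂ ℂ) := by
    funext t
    ext <;> simp [scaleSnd]
  rw [this]
  fun_prop

theorem norm_scaleSnd_apply_le {t : ℝ} (ht : t ∈ Icc (0 : ℝ) 1) (p : ℂ × ℂ) :
    ‖scaleSnd t p‖ ≤ ‖p‖ := by
  rw [scaleSnd_apply, Prod.norm_def, Prod.norm_def]
  refine max_le_max le_rfl ?_
  rw [norm_mul, Complex.norm_real, Real.norm_of_nonneg ht.1]
  exact mul_le_of_le_one_left (norm_nonneg _) ht.2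

theorem scaleSnd_mem_ball {R : ℝ} {t : ℝ} (ht : t ∈ Icc (0 : ℝ) 1) {p : ℂ × ℂ}
    (hp : p ∈ Metric.ball (0 : ℂ × ℂ) R) : scaleSnd t p ∈ Metric.ball (0 : ℂ × ℂ) R := by
  rw [mem_ball_zero_iff] at hp ⊢
  exact (norm_scaleSnd_apply_le ht p).trans_lt hp

section

variable {E E' : Type} [NormedAddCommGroup E] [NormedSpace ℂ E] [NormedAddCommGroup E']
  [NormedSpace ℂ E']

theorem continuousOn_comp_scaleSnd {R : ℝ} {L : ℝ → E →L[ℂ] E'} (hL : Continuous L)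
    {F : ℂ × ℂ → E} (hF : ContinuousOn F (Metric.ball 0 R)) {p : ℂ × ℂ}
    (hp : p ∈ Metric.ball (0 : ℂ × ℂ) R) :
    ContinuousOn (fun t => L t (F (scaleSnd t p))) (Icc 0 1) := by
  apply hL.continuousOn.clm_apply
  apply hF.comp
  · exact (continuous_scaleSnd.clm_apply continuous_const).continuousOn
  · exact fun t ht => scaleSnd_mem_ball ht hp

/-- Differentiation under the integral sign along the dilations `scaleSnd t`. -/
theorem hasFDerivAt_integral_scaleSnd [CompleteSpace E'] {R : ℝ} {L : ℝ → E →L[ℂ] E'} (hL : Continuous L)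
    {F : ℂ × ℂ → E} (hF : ContDiffOn ℂ 1 F (Metric.ball 0 R)) {p : ℂ × ℂ}
    (hp : p ∈ Metric.ball (0 : ℂ × ℂ) R) :
    HasFDerivAt (fun q => ∫ t in (0 : ℝ)..1, L t (F (scaleSnd t q)))
      (∫ t in (0 : ℝ)..1, (L t).comp ((fderiv ℂ F (scaleSnd t p)).comp (scaleSnd t))) p := by
  have hb : IsOpen (Metric.ball (0 : ℂ × ℂ) R) := Metric.isOpen_ball
  have hF' : ContinuousOn (fderiv ℂ F) (Metric.ball 0 R) :=
    hF.continuousOn_fderiv_of_isOpen hb le_rfl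
  have hp' : ‖p‖ < R := by simpa using hp
  obtain ⟨s, hs1, hs2⟩ := exists_between hp'
  have hsub : Metric.closedBall (0 : ℂ × ℂ) s ⊆ Metric.ball 0 R :=
    Metric.closedBall_subset_ball hs2
  obtain ⟨M, hM⟩ := (isCompact_closedBall (0 : ℂ × ℂ) s).exists_bound_of_continuousOn
    (hF'.mono hsub)
  obtain ⟨M', hM'⟩ := (isCompact_Icc (a := (0 : ℝ)) (b := 1)).exists_bound_of_continuousOn
    hL.continuousOn
  obtain ⟨M'', hM''⟩ := (isCompact_Icc (a := (0 : ℝ)) (b := 1)).exists_bound_of_continuousOn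
    continuous_scaleSnd.continuousOn
  have hcd : ContinuousOn
      (fun t => (L t).comp ((fderiv ℂ F (scaleSnd t p)).comp (scaleSnd t))) (Icc 0 1) := by
    apply hL.continuousOn.clm_comp
    apply ContinuousOn.clm_comp _ continuous_scaleSnd.continuousOn
    apply hF'.comp
    · exact (continuous_scaleSnd.clm_apply continuous_const).continuousOn
    · exact fun t ht => scaleSnd_mem_ball ht hp
  have hI : uIoc (0 : ℝ) 1 ⊆ Icc 0 1 := by
    rw [uIoc_of_le zero_le_one]; exact Ioc_subset_Icc_self
  refine intervalIntegral.hasFDerivAt_integral_of_dominated_of_fderiv_le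
    (s := Metric.ball 0 s) (bound := fun _ => M' * (M * M''))
    (F := fun q t => L t (F (scaleSnd t q)))
    (F' := fun q t => (L t).comp ((fderiv ℂ F (scaleSnd t q)).comp (scaleSnd t)))
    (Metric.isOpen_ball.mem_nhds (by simpa using hs1)) ?_ ?_ ?_ ?_ ?_ ?_
  · filter_upwards [hb.mem_nhds hp] with q hq
    exact ((continuousOn_comp_scaleSnd hL hF.continuousOn hq).mono hI).aestronglyMeasurable
      measurableSet_uIoc
  · apply ContinuousOn.intervalIntegrable
    rw [uIcc_of_le zero_le_one]
    exact continuousOn_comp_scaleSnd hL hF.continuousOn hp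
  · exact (hcd.mono hI).aestronglyMeasurable measurableSet_uIoc
  · refine Filter.Eventually.of_forall fun t ht q hq => ?_
    have ht' := hI ht
    have hq' : scaleSnd t q ∈ Metric.closedBall (0 : ℂ × ℂ) s := by
      rw [mem_closedBall_zero_iff]
      exact (norm_scaleSnd_apply_le ht' q).trans (by simpa using (mem_ball_zero_iff.1 hq).le)
    have hM0 : 0 ≤ M := (norm_nonneg _).trans (hM _ hq')
    have hM'0 : 0 ≤ M' := (norm_nonneg _).trans (hM' _ ht')
    refine (ContinuousLinearMap.opNorm_comp_le _ _).trans ?_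
    refine mul_le_mul (hM' _ ht') ?_ (norm_nonneg _) hM'0
    refine (ContinuousLinearMap.opNorm_comp_le _ _).trans ?_
    exact mul_le_mul (hM _ hq') (hM'' _ ht') (norm_nonneg _) hM0
  · exact intervalIntegrable_const
  · refine Filter.Eventually.of_forall fun t ht q hq => ?_
    have hq' : scaleSnd t q ∈ Metric.ball (0 : ℂ × ℂ) R :=
      scaleSnd_mem_ball (hI ht) (Metric.ball_subset_ball hs2.le hq)
    have hd : HasFDerivAt F (fderiv ℂ F (scaleSnd t q)) (scaleSnd t q) :=
      ((hF.differentiableOn one_ne_zero).differentiableAt (hb.mem_nhds hq')).hasFDerivAt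
    exact (L t).hasFDerivAt.comp q (hd.comp q (scaleSnd t).hasFDerivAt)

end

theorem contDiffOn_integral_scaleSnd {R : ℝ} (n : ℕ) : ∀ {E E' : Type} [NormedAddCommGroup E]
    [NormedSpace ℂ E] [NormedAddCommGroup E'] [NormedSpace ℂ E'] [CompleteSpace E']
    {L : ℝ → E →L[ℂ] E'} (_ : Continuous L) {F : ℂ × ℂ → E}
    (_ : ContDiffOn ℂ ∞ F (Metric.ball 0 R)),
    ContDiffOn ℂ n (fun q => ∫ t in (0 : ℝ)..1, L t (F (scaleSnd t q))) (Metric.ball 0 R) := by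
  induction n with
  | zero =>
    intro E E' _ _ _ _ _ L hL F hF
    rw [Nat.cast_zero, contDiffOn_zero]
    intro p hp
    exact (hasFDerivAt_integral_scaleSnd hL (hF.of_le (by simp)) hp).continuousAt.continuousWithinAt
  | succ n ih =>
    intro E E' _ _ _ _ _ L hL F hF
    have hb : IsOpen (Metric.ball (0 : ℂ × ℂ) R) := Metric.isOpen_ball
    have hder := fun (p : ℂ × ℂ) (hp : p ∈ Metric.ball (0 : ℂ × ℂ) R) =>
      hasFDerivAt_integral_scaleSnd hL (hF.of_le (by simp)) hp
    push_cast
    rw [contDiffOn_succ_iff_fderiv_of_isOpen hb]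
    refine ⟨fun p hp => (hder p hp).differentiableAt.differentiableWithinAt, by simp, ?_⟩
    have hL' : Continuous fun t => (ContinuousLinearMap.compL ℂ (ℂ × ℂ) E E' (L t)).comp
        ((ContinuousLinearMap.compL ℂ (ℂ × ℂ) (ℂ × ℂ) E).flip (scaleSnd t)) :=
      ((ContinuousLinearMap.compL ℂ (ℂ × ℂ) E E').continuous.comp hL).clm_comp
        ((ContinuousLinearMap.continuous _).comp continuous_scaleSnd)
    refine (ih hL' (F := fderiv ℂ F) (hF.fderiv_of_isOpen hb (by simp))).congr fun p hp => ?_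
    rw [(hder p hp).fderiv]
    rfl

/-- The primitive `∫₀^ζ F(z, s) ds` of `F` in the second variable, along the segment from `0`
to `ζ`. -/
noncomputable def primSnd (F : ℂ × ℂ → ℂ) (p : ℂ × ℂ) : ℂ :=
  p.2 * ∫ t in (0 : ℝ)..1, F (scaleSnd t p)

/-- The partial derivative `∂_z` of a function of `(z, ζ) ∈ ℂ²`. -/
noncomputable def dFst (F : ℂ × ℂ → ℂ) (p : ℂ × ℂ) : ℂ := fderiv ℂ F p (1, 0)

/-- The partial derivative `∂_ζ` of a function of `(z, ζ) ∈ ℂ²`. -/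
noncomputable def dSnd (F : ℂ × ℂ → ℂ) (p : ℂ × ℂ) : ℂ := fderiv ℂ F p (0, 1)

section

variable {F G : ℂ × ℂ → ℂ} {R : ℝ}

theorem contDiffOn_primSnd (hF : ContDiffOn ℂ ∞ F (Metric.ball 0 R)) :
    ContDiffOn ℂ ∞ (primSnd F) (Metric.ball 0 R) := by
  refine contDiff_snd.contDiffOn.mul (contDiffOn_infty.2 fun n => ?_)
  exact contDiffOn_integral_scaleSnd n (L := fun _ => ContinuousLinearMap.id ℂ ℂ)
    continuous_const hF

theorem contDiffOn_dFst (hF : ContDiffOn ℂ ∞ F (Metric.ball 0 R)) :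
    ContDiffOn ℂ ∞ (dFst F) (Metric.ball 0 R) :=
  (hF.fderiv_of_isOpen Metric.isOpen_ball (by simp)).clm_apply contDiffOn_const

theorem contDiffOn_dSnd (hF : ContDiffOn ℂ ∞ F (Metric.ball 0 R)) :
    ContDiffOn ℂ ∞ (dSnd F) (Metric.ball 0 R) :=
  (hF.fderiv_of_isOpen Metric.isOpen_ball (by simp)).clm_apply contDiffOn_const

theorem ContDiffOn.differentiableAt_ball (hF : ContDiffOn ℂ ∞ F (Metric.ball 0 R)) {p : ℂ × ℂ}
    (hp : p ∈ Metric.ball (0 : ℂ × ℂ) R) : DifferentiableAt ℂ F p :=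
  (hF.differentiableOn (by simp)).differentiableAt (Metric.isOpen_ball.mem_nhds hp)

theorem hasDerivAt_slice_fst {z ζ : ℂ} (hF : DifferentiableAt ℂ F (z, ζ)) :
    HasDerivAt (fun s => F (s, ζ)) (dFst F (z, ζ)) z :=
  hF.hasFDerivAt.comp_hasDerivAt z ((hasDerivAt_id z).prodMk (hasDerivAt_const z ζ))

theorem norm_primSnd_le {M : ℝ} {p : ℂ × ℂ}
    (hM : ∀ t ∈ Icc (0 : ℝ) 1, ‖F (scaleSnd t p)‖ ≤ M) : ‖primSnd F p‖ ≤ ‖p.2‖ * M := by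
  rw [primSnd, norm_mul]
  refine mul_le_mul_of_nonneg_left ?_ (norm_nonneg _)
  have := intervalIntegral.norm_integral_le_of_norm_le_const (a := (0 : ℝ)) (b := 1) (C := M)
    (f := fun t => F (scaleSnd t p)) fun t ht => hM t (by
      rw [uIoc_of_le zero_le_one] at ht; exact Ioc_subset_Icc_self ht)
  simpa using this

/-- `primSnd F` is a primitive of `F` in `ζ`. -/
theorem dSnd_primSnd (hF : ContDiffOn ℂ ∞ F (Metric.ball 0 R)) {p : ℂ × ℂ}
    (hp : p ∈ Metric.ball (0 : ℂ × ℂ) R) : dSnd (primSnd F) p = F p := by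
  have h1 := hasFDerivAt_integral_scaleSnd (L := fun _ => ContinuousLinearMap.id ℂ ℂ)
    continuous_const (hF.of_le (by simp)) hp
  have h2 := (ContinuousLinearMap.snd ℂ ℂ ℂ).hasFDerivAt (x := p) |>.mul h1
  have h3 : HasFDerivAt (primSnd F) _ p := h2
  have hb : IsOpen (Metric.ball (0 : ℂ × ℂ) R) := Metric.isOpen_ball
  have hFc : ContinuousOn (fderiv ℂ F) (Metric.ball 0 R) :=
    hF.continuousOn_fderiv_of_isOpen hb (by simp)
  have hcd : ContinuousOn
      (fun t => (fderiv ℂ F (scaleSnd t p)).comp (scaleSnd t)) (Icc 0 1) := by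
    apply ContinuousOn.clm_comp _ continuous_scaleSnd.continuousOn
    apply hFc.comp
    · exact (continuous_scaleSnd.clm_apply continuous_const).continuousOn
    · exact fun t ht => scaleSnd_mem_ball ht hp
  have hint : IntervalIntegrable (fun t => (ContinuousLinearMap.id ℂ ℂ).comp
      ((fderiv ℂ F (scaleSnd t p)).comp (scaleSnd t))) volume 0 1 := by
    apply ContinuousOn.intervalIntegrable
    rw [uIcc_of_le zero_le_one]
    exact hcd
  have hint' : IntervalIntegrable (fun t => fderiv ℂ F (scaleSnd t p) (0, p.2) * t) volume 0 1 := by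
    apply ContinuousOn.intervalIntegrable
    rw [uIcc_of_le zero_le_one]
    refine (ContinuousOn.clm_apply ?_ continuousOn_const).mul
      Complex.continuous_ofReal.continuousOn
    apply hFc.comp
    · exact (continuous_scaleSnd.clm_apply continuous_const).continuousOn
    · exact fun t ht => scaleSnd_mem_ball ht hp
  have hint0 : IntervalIntegrable (fun t => F (scaleSnd t p)) volume 0 1 := by
    apply ContinuousOn.intervalIntegrable
    rw [uIcc_of_le zero_le_one]
    exact continuousOn_comp_scaleSnd (L := fun _ => ContinuousLinearMap.id ℂ ℂ)
      continuous_const hF.continuousOn hp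
  -- integrate `d/dt (t F(z, tζ))` over `[0, 1]`
  have key : ∫ t in (0 : ℝ)..1, (fderiv ℂ F (scaleSnd t p) (0, p.2) * t + F (scaleSnd t p)) =
      F p := by
    have hd : ∀ t ∈ uIcc (0 : ℝ) 1, HasDerivAt (fun t : ℝ => F (scaleSnd t p) * (t : ℂ))
        (fderiv ℂ F (scaleSnd t p) (0, p.2) * t + F (scaleSnd t p)) t := by
      intro t ht
      rw [uIcc_of_le zero_le_one] at ht
      have hFt := (hF.differentiableAt_ball (scaleSnd_mem_ball ht hp)).hasFDerivAt
      have hs : HasDerivAt (fun t : ℝ => scaleSnd t p) ((0 : ℂ), p.2) t := by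
        have h5 : HasDerivAt (fun t : ℝ => (t : ℂ)) 1 t := Complex.ofRealCLM.hasDerivAt
        have h6 := (hasDerivAt_const t p.1).prodMk (h5.mul_const p.2)
        simpa using h6
      have := ((hFt.restrictScalars ℝ).comp_hasDerivAt t hs).mul
        (Complex.ofRealCLM.hasDerivAt (x := t))
      exact this.congr_deriv (by simp)
    rw [intervalIntegral.integral_eq_sub_of_hasDerivAt hd (hint'.add hint0)]
    simp
  rw [intervalIntegral.integral_add hint' hint0] at key
  rw [dSnd, h3.fderiv]
  simp only [add_apply, smul_apply,
    ContinuousLinearMap.coe_snd', smul_eq_mul, ContinuousLinearMap.coe_id', id_eq, mul_one]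
  rw [ContinuousLinearMap.intervalIntegral_apply hint, ← key,
    ← intervalIntegral.integral_const_mul]
  simp only [ContinuousLinearMap.comp_apply, ContinuousLinearMap.coe_id', id_eq, scaleSnd_apply,
    mul_one]
  congr 1
  refine intervalIntegral.integral_congr fun t _ => ?_
  have : ((0 : ℂ), (t : ℂ)) = (t : ℂ) • ((0 : ℂ), (1 : ℂ)) := by simp
  have h' : ((0 : ℂ), p.2) = p.2 • ((0 : ℂ), (1 : ℂ)) := by simp
  simp only [this, h', map_smul, smul_eq_mul]
  ring

/-- Cauchy's estimate for `∂_z` on a bidisc. -/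
theorem norm_dFst_le {s δ M : ℝ} (hδ : 0 < δ) (hs : s + δ ≤ R)
    (hF : ContDiffOn ℂ ∞ F (Metric.ball 0 R))
    (hM : ∀ p ∈ Metric.ball (0 : ℂ × ℂ) (s + δ), ‖F p‖ ≤ M) {p : ℂ × ℂ}
    (hp : p ∈ Metric.ball (0 : ℂ × ℂ) s) : ‖dFst F p‖ ≤ M / δ := by
  obtain ⟨z, ζ⟩ := p
  have hmem : ∀ x ∈ Metric.closedBall z δ, (x, ζ) ∈ Metric.ball (0 : ℂ × ℂ) (s + δ) := by
    intro x hx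
    rw [mem_ball_zero_iff, Prod.norm_def, max_lt_iff] at hp ⊢
    have h1 : ‖x - z‖ ≤ δ := by simpa [dist_eq_norm] using hx
    have h2 : ‖x‖ ≤ ‖x - z‖ + ‖z‖ := by simpa using norm_add_le (x - z) z
    exact ⟨by have := hp.1; simp only at this ⊢; linarith,
      by have := hp.2; simp only at this ⊢; linarith⟩
  have hsub : Metric.ball (0 : ℂ × ℂ) (s + δ) ⊆ Metric.ball 0 R := Metric.ball_subset_ball hs
  have hdiff : ∀ x ∈ Metric.closedBall z δ, DifferentiableAt ℂ (fun x => F (x, ζ)) x :=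
    fun x hx => (hasDerivAt_slice_fst
      (hF.differentiableAt_ball (hsub (hmem x hx)))).differentiableAt
  have hz := hasDerivAt_slice_fst
    (hF.differentiableAt_ball (hsub (hmem z (Metric.mem_closedBall_self hδ.le))))
  rw [← hz.deriv]
  refine Complex.norm_deriv_le_of_forall_mem_sphere_norm_le hδ ?_ fun x hx =>
    hM _ (hmem x (Metric.sphere_subset_closedBall hx))
  apply DifferentiableOn.diffContOnCl
  intro x hx
  rw [closure_ball z hδ.ne'] at hx
  exact (hdiff x hx).differentiableWithinAt

end

/-! ### Complexification of a real-analytic function of two variables -/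

/-- The embedding `y ↦ (y₁ + i y₂, y₁ - i y₂)` of the plane into `ℂ²`: its image is `ζ = z̄`. -/
noncomputable def diagEmb : Plane →L[ℝ] ℂ × ℂ :=
  ((EuclideanSpace.proj 0 : Plane →L[ℝ] ℝ).smulRight ((1 : ℂ), (1 : ℂ))) +
    ((EuclideanSpace.proj 1 : Plane →L[ℝ] ℝ).smulRight (Complex.I, -Complex.I))

theorem diagEmb_apply (y : Plane) :
    diagEmb y = ((y 0 : ℂ) + y 1 * Complex.I, (y 0 : ℂ) - y 1 * Complex.I) := by
  simp [diagEmb, sub_eq_add_neg]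

theorem norm_diagEmb (y : Plane) : ‖diagEmb y‖ = ‖y‖ := by
  have h1 : ‖(y 0 : ℂ) + y 1 * Complex.I‖ = ‖y‖ := by
    rw [Complex.norm_add_mul_I, EuclideanSpace.norm_eq]
    simp
  have h2 : ‖(y 0 : ℂ) - y 1 * Complex.I‖ = ‖y‖ := by
    have : (y 0 : ℂ) - y 1 * Complex.I = (y 0 : ℂ) + ((-y 1 : ℝ) : ℂ) * Complex.I := by
      push_cast; ring
    rw [this, Complex.norm_add_mul_I, EuclideanSpace.norm_eq]
    simp
  rw [diagEmb_apply, Prod.norm_def]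
  simp only [h1, h2, max_self]

/-- The coordinates of the plane, continued to `ℂ²`: `(z + ζ) / 2` and `(z - ζ) / (2i)`. -/
noncomputable def complexCoord (j : Fin 2) : ℂ × ℂ →L[ℂ] ℂ :=
  if j = 0 then (1 / 2 : ℂ) • (ContinuousLinearMap.fst ℂ ℂ ℂ + ContinuousLinearMap.snd ℂ ℂ ℂ)
  else (-Complex.I / 2) • (ContinuousLinearMap.fst ℂ ℂ ℂ - ContinuousLinearMap.snd ℂ ℂ ℂ)

theorem complexCoord_diagEmb (j : Fin 2) (y : Plane) : complexCoord j (diagEmb y) = (y j : ℂ) := by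
  fin_cases j
  · simp [complexCoord, diagEmb_apply]
    ring
  · simp [complexCoord, diagEmb_apply]
    linear_combination (-(y 1 : ℂ)) * Complex.I_sq

theorem norm_complexCoord_le (j : Fin 2) : ‖complexCoord j‖ ≤ 1 := by
  refine ContinuousLinearMap.opNorm_le_bound _ zero_le_one fun p => ?_
  have h1 := norm_fst_le p
  have h2 := norm_snd_le p
  fin_cases j
  · have := norm_add_le p.1 p.2
    simp [complexCoord, ← mul_add]
    linarith
  · have := norm_sub_le p.1 p.2
    simp [complexCoord]
    linarith

theorem sum_smul_basisVec (y : Plane) : ∑ j, y j • basisVec j = y := by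
  ext i
  fin_cases i <;> simp [basisVec]

/-- The complexification of a formal power series on the plane. -/
noncomputable def complexify (p : FormalMultilinearSeries ℝ Plane ℂ) :
    FormalMultilinearSeries ℂ (ℂ × ℂ) ℂ := fun n =>
  ∑ s : Fin n → Fin 2, p n (fun i => basisVec (s i)) •
    (ContinuousMultilinearMap.mkPiAlgebra ℂ (Fin n) ℂ).compContinuousLinearMap
      fun i => complexCoord (s i)

theorem complexify_apply_diagEmb (p : FormalMultilinearSeries ℝ Plane ℂ) (n : ℕ) (y : Plane) :
    (complexify p n fun _ => diagEmb y) = p n fun _ => y := by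
  have h1 : (p n fun _ => y) = p n fun _ : Fin n => ∑ j, y j • basisVec j := by
    simp only [sum_smul_basisVec]
  have h2 := (p n).toMultilinearMap.map_sum (fun (_ : Fin n) (j : Fin 2) => y j • basisVec j)
  simp only [ContinuousMultilinearMap.coe_coe] at h2
  rw [h1, h2]
  simp only [complexify, sum_apply, smul_apply,
    ContinuousMultilinearMap.compContinuousLinearMap_apply,
    ContinuousMultilinearMap.mkPiAlgebra_apply, complexCoord_diagEmb]
  refine Finset.sum_congr rfl fun s _ => ?_
  have h3 := (p n).map_smul_univ (fun i => y (s i)) (fun i => basisVec (s i))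
  rw [h3]
  simp [mul_comm]

theorem norm_complexify_le (p : FormalMultilinearSeries ℝ Plane ℂ) (n : ℕ) :
    ‖complexify p n‖ ≤ 2 ^ n * ‖p n‖ := by
  have hb : ∀ j, ‖basisVec j‖ = 1 := fun j => by simp [basisVec]
  refine (norm_sum_le _ _).trans ?_
  have : ∀ s : Fin n → Fin 2, ‖p n (fun i => basisVec (s i)) •
      (ContinuousMultilinearMap.mkPiAlgebra ℂ (Fin n) ℂ).compContinuousLinearMap
      fun i => complexCoord (s i)‖ ≤ ‖p n‖ := by
    intro s
    rw [norm_smul]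
    have h1 : ‖p n (fun i => basisVec (s i))‖ ≤ ‖p n‖ := by
      simpa [hb] using (p n).le_opNorm (fun i => basisVec (s i))
    have h2 : ‖(ContinuousMultilinearMap.mkPiAlgebra ℂ (Fin n) ℂ).compContinuousLinearMap
        fun i => complexCoord (s i)‖ ≤ 1 := by
      refine (ContinuousMultilinearMap.norm_compContinuousLinearMap_le _ _).trans ?_
      refine mul_le_one₀ (by simp) (by positivity) ?_
      exact Finset.prod_le_one (fun i _ => norm_nonneg _) fun i _ => norm_complexCoord_le _
    exact (mul_le_mul h1 h2 (norm_nonneg _) (norm_nonneg _)).trans_eq (mul_one _)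
  refine (Finset.sum_le_sum fun s _ => this s).trans ?_
  simp

/-- A real-analytic function on the plane is the trace on `ζ = z̄` of a holomorphic function on a
bidisc of `ℂ²`. -/
theorem AnalyticAt.exists_complexification {f : Plane → ℂ} {x : Plane} (hf : AnalyticAt ℝ f x) :
    ∃ R > 0, ∃ G : ℂ × ℂ → ℂ, ContDiffOn ℂ ∞ G (Metric.ball 0 R) ∧
      ∀ y : Plane, ‖y‖ < R → f (x + y) = G (diagEmb y) := by
  obtain ⟨p, r, hp⟩ := hf
  obtain ⟨s, hs0, hs⟩ := ENNReal.lt_iff_exists_nnreal_btwn.1 hp.r_pos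
  obtain ⟨C, -, hC⟩ := p.norm_mul_pow_le_of_lt_radius (hs.trans_le hp.r_le)
  have hs0' : 0 < s := by exact_mod_cast hs0
  have hrad : ((s / 2 : NNReal) : ENNReal) ≤ (complexify p).radius := by
    refine FormalMultilinearSeries.le_radius_of_bound _ C fun n => ?_
    refine le_trans ?_ (hC n)
    calc ‖complexify p n‖ * ((s / 2 : NNReal) : ℝ) ^ n
        ≤ (2 ^ n * ‖p n‖) * ((s / 2 : NNReal) : ℝ) ^ n := by
          gcongr; exact norm_complexify_le p n
      _ = ‖p n‖ * (s : ℝ) ^ n := by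
          push_cast
          rw [div_pow]
          field_simp
  have hpos : (0 : ENNReal) < (s / 2 : NNReal) := by
    exact_mod_cast half_pos hs0'
  have hser := (complexify p).hasFPowerSeriesOnBall (hpos.trans_le hrad)
  have hball : Metric.ball (0 : ℂ × ℂ) (s / 2 : NNReal) ⊆ Metric.eball 0 (complexify p).radius := by
    intro q hq
    rw [← Metric.eball_coe] at hq
    exact Metric.eball_subset_eball hrad hq
  refine ⟨(s / 2 : NNReal), by exact_mod_cast half_pos hs0', (complexify p).sum, ?_, ?_⟩
  · intro q hq
    exact (hser.analyticOnNhd q (hball hq)).contDiffAt.contDiffWithinAt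
  · intro y hy
    have h1 : y ∈ Metric.eball (0 : Plane) r := by
      refine Metric.eball_subset_eball hs.le ?_
      rw [Metric.eball_coe, mem_ball_zero_iff]
      refine hy.trans_le ?_
      push_cast
      linarith [s.coe_nonneg]
    have h2 := hp.hasSum h1
    have h3 := hser.hasSum (y := diagEmb y) (hball (by simpa [norm_diagEmb] using hy))
    simp only [complexify_apply_diagEmb, zero_add] at h3
    exact h2.unique h3

/-! ### The amplitude: a truncated expansion with exponentially small remainder -/

/-- The terms `y_j` of the expansion of `y = ∂_ζ v`, where `v = 1 + ∫₀^ζ y` and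
`y = 4hk ∂_z y - m v`: thus `y₀ = -m` and `y_{j+1} = 4hk ∂_z y_j - m ∫₀^ζ y_j`. They are used with
`k = 1 / (2iw)` and `m = (B - μ) / (2iw)`. -/
noncomputable def amplitudeTerm (k m : ℂ × ℂ → ℂ) (h : ℝ) : ℕ → ℂ × ℂ → ℂ
  | 0 => fun p => -m p
  | j + 1 => fun p => 4 * h * k p * dFst (amplitudeTerm k m h j) p -
      m p * primSnd (amplitudeTerm k m h j) p

/-- The amplitude `v = 1 + ∑_{j < N} ∫₀^ζ y_j`. -/
noncomputable def amplitude (k m : ℂ × ℂ → ℂ) (h : ℝ) (N : ℕ) (p : ℂ × ℂ) : ℂ :=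
  1 + ∑ j ∈ Finset.range N, primSnd (amplitudeTerm k m h j) p

section

variable {k m : ℂ × ℂ → ℂ} {R h : ℝ}

theorem contDiffOn_amplitudeTerm (hk : ContDiffOn ℂ ∞ k (Metric.ball 0 R))
    (hm : ContDiffOn ℂ ∞ m (Metric.ball 0 R)) (j : ℕ) :
    ContDiffOn ℂ ∞ (amplitudeTerm k m h j) (Metric.ball 0 R) := by
  induction j with
  | zero => exact hm.neg
  | succ j ih =>
    exact ((contDiffOn_const.mul hk).mul (contDiffOn_dFst ih)).sub (hm.mul (contDiffOn_primSnd ih))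

theorem contDiffOn_amplitude (hk : ContDiffOn ℂ ∞ k (Metric.ball 0 R))
    (hm : ContDiffOn ℂ ∞ m (Metric.ball 0 R)) (N : ℕ) :
    ContDiffOn ℂ ∞ (amplitude k m h N) (Metric.ball 0 R) :=
  contDiffOn_const.add (ContDiffOn.sum fun j _ =>
    contDiffOn_primSnd (contDiffOn_amplitudeTerm hk hm j))

theorem dSnd_amplitude (hk : ContDiffOn ℂ ∞ k (Metric.ball 0 R))
    (hm : ContDiffOn ℂ ∞ m (Metric.ball 0 R)) (N : ℕ) {p : ℂ × ℂ}
    (hp : p ∈ Metric.ball (0 : ℂ × ℂ) R) :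
    dSnd (amplitude k m h N) p = ∑ j ∈ Finset.range N, amplitudeTerm k m h j p := by
  have hd : ∀ j ∈ Finset.range N, HasFDerivAt (primSnd (amplitudeTerm k m h j))
      (fderiv ℂ (primSnd (amplitudeTerm k m h j)) p) p := fun j _ =>
    ((contDiffOn_primSnd (contDiffOn_amplitudeTerm hk hm j)).differentiableAt_ball hp).hasFDerivAt
  have h1 : HasFDerivAt (amplitude k m h N) _ p := (HasFDerivAt.fun_sum hd).const_add 1
  rw [dSnd, h1.fderiv, sum_apply]
  exact Finset.sum_congr rfl fun j _ => dSnd_primSnd (contDiffOn_amplitudeTerm hk hm j) hp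

theorem dFst_dSnd_amplitude (hk : ContDiffOn ℂ ∞ k (Metric.ball 0 R))
    (hm : ContDiffOn ℂ ∞ m (Metric.ball 0 R)) (N : ℕ) {p : ℂ × ℂ}
    (hp : p ∈ Metric.ball (0 : ℂ × ℂ) R) :
    dFst (dSnd (amplitude k m h N)) p =
      ∑ j ∈ Finset.range N, dFst (amplitudeTerm k m h j) p := by
  have hev : dSnd (amplitude k m h N) =ᶠ[nhds p]
      fun q => ∑ j ∈ Finset.range N, amplitudeTerm k m h j q := by
    filter_upwards [Metric.isOpen_ball.mem_nhds hp] with q hq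
    exact dSnd_amplitude hk hm N hq
  have hd : ∀ j ∈ Finset.range N, HasFDerivAt (amplitudeTerm k m h j)
      (fderiv ℂ (amplitudeTerm k m h j) p) p := fun j _ =>
    ((contDiffOn_amplitudeTerm hk hm j).differentiableAt_ball hp).hasFDerivAt
  rw [dFst, hev.fderiv_eq, (HasFDerivAt.fun_sum hd).fderiv, sum_apply]
  rfl

/-- The equation for `v` telescopes: only the last term of the expansion remains. -/
theorem amplitude_equation (hk : ContDiffOn ℂ ∞ k (Metric.ball 0 R))
    (hm : ContDiffOn ℂ ∞ m (Metric.ball 0 R)) (N : ℕ) {p : ℂ × ℂ}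
    (hp : p ∈ Metric.ball (0 : ℂ × ℂ) R) :
    -4 * h * k p * dFst (dSnd (amplitude k m h N)) p + dSnd (amplitude k m h N) p +
      m p * amplitude k m h N p = -amplitudeTerm k m h N p := by
  rw [dSnd_amplitude hk hm N hp, dFst_dSnd_amplitude hk hm N hp, amplitude]
  induction N with
  | zero => simp [amplitudeTerm]
  | succ N ih =>
    simp only [Finset.sum_range_succ]
    have : amplitudeTerm k m h (N + 1) p = 4 * h * k p * dFst (amplitudeTerm k m h N) p -
      m p * primSnd (amplitudeTerm k m h N) p := rfl
    rw [this]
    linear_combination ih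

/-- On bidiscs whose radius decreases linearly with `j`, from `2r` down to `r`, each step of the
expansion gains a factor `1 / 2`, as long as their number `N` is at most a small multiple
of `1 / h`. -/
theorem norm_amplitudeTerm_le (hk : ContDiffOn ℂ ∞ k (Metric.ball 0 R))
    (hm : ContDiffOn ℂ ∞ m (Metric.ball 0 R)) {r K : ℝ} {N : ℕ} (hr : 0 < r) (hrR : 2 * r ≤ R)
    (hh : 0 ≤ h) (hN : 0 < N) (hK : 0 ≤ K)
    (hkK : ∀ p ∈ Metric.ball (0 : ℂ × ℂ) (2 * r), ‖k p‖ ≤ K)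
    (hmK : ∀ p ∈ Metric.ball (0 : ℂ × ℂ) (2 * r), ‖m p‖ ≤ K)
    (hrK : 8 * r * K ≤ 1) (hNh : 16 * K * h * N ≤ r) (j : ℕ) (hj : j ≤ N) :
    ∀ p ∈ Metric.ball (0 : ℂ × ℂ) (2 * r - j * (r / N)), ‖amplitudeTerm k m h j p‖ ≤ K / 2 ^ j := by
  have hN' : (0 : ℝ) < N := by exact_mod_cast hN
  have hδ : 0 < r / N := by positivity
  induction j with
  | zero =>
    intro p hp
    simpa [amplitudeTerm] using hmK p (by simpa using hp)
  | succ j ih =>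
    intro p hp
    have hih := ih (by omega)
    have hrad : 2 * r - ((j + 1 : ℕ) : ℝ) * (r / N) + r / N = 2 * r - j * (r / N) := by
      push_cast; ring
    have hj0 : 0 ≤ (j : ℝ) * (r / N) := by positivity
    have hp2 : p ∈ Metric.ball (0 : ℂ × ℂ) (2 * r) := by
      refine Metric.ball_subset_ball ?_ hp
      push_cast; nlinarith
    have hpj : p ∈ Metric.ball (0 : ℂ × ℂ) (2 * r - j * (r / N)) := by
      refine Metric.ball_subset_ball ?_ hp
      push_cast; nlinarith
    have hKj : 0 ≤ K / 2 ^ j := by positivity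
    have h1 : ‖dFst (amplitudeTerm k m h j) p‖ ≤ K / 2 ^ j / (r / N) := by
      refine norm_dFst_le (R := R) hδ (by rw [hrad]; linarith)
        (contDiffOn_amplitudeTerm hk hm j) (fun q hq => hih q ?_) hp
      rwa [hrad] at hq
    have h2 : ‖primSnd (amplitudeTerm k m h j) p‖ ≤ 2 * r * (K / 2 ^ j) := by
      refine (norm_primSnd_le fun t ht => hih _ (scaleSnd_mem_ball ht hpj)).trans ?_
      refine mul_le_mul_of_nonneg_right ?_ hKj
      exact (norm_snd_le p).trans (mem_ball_zero_iff.1 hp2).le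
    have e1 : ‖4 * (h : ℂ) * k p * dFst (amplitudeTerm k m h j) p‖ ≤ (K / 2 ^ j) / 4 := by
      rw [norm_mul, norm_mul, norm_mul, Complex.norm_real, Real.norm_of_nonneg hh]
      have h4 : ‖(4 : ℂ)‖ = 4 := by simp
      rw [h4]
      calc 4 * h * ‖k p‖ * ‖dFst (amplitudeTerm k m h j) p‖
          ≤ 4 * h * K * (K / 2 ^ j / (r / N)) := by
            gcongr
            exact hkK p hp2
        _ = (16 * K * h * N / r) * ((K / 2 ^ j) / 4) := by
            field_simp; ring
        _ ≤ 1 * ((K / 2 ^ j) / 4) := by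
            gcongr
            rw [div_le_one hr]; exact hNh
        _ = _ := one_mul _
    have e2 : ‖m p * primSnd (amplitudeTerm k m h j) p‖ ≤ (K / 2 ^ j) / 4 := by
      rw [norm_mul]
      calc ‖m p‖ * ‖primSnd (amplitudeTerm k m h j) p‖ ≤ K * (2 * r * (K / 2 ^ j)) := by
            gcongr
            exact hmK p hp2
        _ = (8 * r * K) * ((K / 2 ^ j) / 4) := by ring
        _ ≤ 1 * ((K / 2 ^ j) / 4) := by gcongr
        _ = _ := one_mul _
    calc ‖amplitudeTerm k m h (j + 1) p‖ ≤ (K / 2 ^ j) / 4 + (K / 2 ^ j) / 4 :=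
          (norm_sub_le _ _).trans (add_le_add e1 e2)
      _ = K / 2 ^ (j + 1) := by rw [pow_succ]; ring

end

/-- For `w(0) ≠ 0`, the equation `-4h ∂_z∂_ζ v + 2iw ∂_ζ v + (G - μ) v = 0` has approximate
solutions near `0`, close to `1`, with an error which is exponentially small in `1 / h`. -/
theorem exists_amplitude {w G : ℂ × ℂ → ℂ} {R : ℝ} (hR : 0 < R)
    (hw : ContDiffOn ℂ ∞ w (Metric.ball 0 R)) (hG : ContDiffOn ℂ ∞ G (Metric.ball 0 R))
    (hw0 : w 0 ≠ 0) (μ : ℂ) :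
    ∃ ρ > 0, ρ ≤ R ∧ ∃ c > 0, ∃ K > 0, ∃ h₀ > 0, ∀ h : ℝ, 0 < h → h ≤ h₀ →
      ∃ v : ℂ × ℂ → ℂ, ContDiffOn ℂ ∞ v (Metric.ball 0 ρ) ∧
        ∀ p ∈ Metric.ball (0 : ℂ × ℂ) ρ, ‖v p - 1‖ ≤ 1 / 2 ∧ ‖dFst v p‖ ≤ K ∧ ‖dSnd v p‖ ≤ K ∧
          ‖-4 * h * dFst (dSnd v) p + 2 * Complex.I * w p * dSnd v p + (G p - μ) * v p‖ ≤
            K * Real.exp (-c / h) := by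
  have hmem0 : (0 : ℂ × ℂ) ∈ Metric.ball (0 : ℂ × ℂ) R := Metric.mem_ball_self hR
  have hwc : ContinuousAt w 0 := (hw.differentiableAt_ball hmem0).continuousAt
  obtain ⟨R₁, hR₁, hR₁w⟩ := Metric.eventually_nhds_iff_ball.1 (hwc.eventually_ne hw0)
  obtain ⟨R₂, hR₂, hR₂'⟩ := exists_between (lt_min hR hR₁)
  have hsub : Metric.closedBall (0 : ℂ × ℂ) R₂ ⊆ Metric.ball 0 R :=
    Metric.closedBall_subset_ball (hR₂'.trans_le (min_le_left _ _))
  have hwne : ∀ p ∈ Metric.closedBall (0 : ℂ × ℂ) R₂, w p ≠ 0 := fun p hp =>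
    hR₁w p (Metric.closedBall_subset_ball (hR₂'.trans_le (min_le_right _ _)) hp)
  have hbs : Metric.ball (0 : ℂ × ℂ) R₂ ⊆ Metric.closedBall 0 R₂ := Metric.ball_subset_closedBall
  set k : ℂ × ℂ → ℂ := fun p => (2 * Complex.I * w p)⁻¹ with hk_def
  set m : ℂ × ℂ → ℂ := fun p => (G p - μ) * k p with hm_def
  have h2iw : ∀ p ∈ Metric.closedBall (0 : ℂ × ℂ) R₂, 2 * Complex.I * w p ≠ 0 := fun p hp =>
    mul_ne_zero (mul_ne_zero two_ne_zero Complex.I_ne_zero) (hwne p hp)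
  have hk' : ContDiffOn ℂ ∞ k (Metric.closedBall 0 R₂) :=
    (contDiffOn_const.mul (hw.mono hsub)).inv h2iw
  have hm' : ContDiffOn ℂ ∞ m (Metric.closedBall 0 R₂) :=
    ((hG.mono hsub).sub contDiffOn_const).mul hk'
  have hk := hk'.mono hbs
  have hm := hm'.mono hbs
  have hcomp := isCompact_closedBall (0 : ℂ × ℂ) R₂
  obtain ⟨K₁, hK₁⟩ := hcomp.exists_bound_of_continuousOn hk'.continuousOn
  obtain ⟨K₂, hK₂⟩ := hcomp.exists_bound_of_continuousOn hm'.continuousOn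
  obtain ⟨W, hW⟩ := hcomp.exists_bound_of_continuousOn (hw.mono hsub).continuousOn
  set K : ℝ := max 1 (max K₁ K₂) with hKdef
  have hK1 : 1 ≤ K := le_max_left _ _
  have hK0 : 0 < K := by linarith
  have hkK : ∀ p ∈ Metric.closedBall (0 : ℂ × ℂ) R₂, ‖k p‖ ≤ K := fun p hp =>
    (hK₁ p hp).trans ((le_max_left _ _).trans (le_max_right _ _))
  have hmK : ∀ p ∈ Metric.closedBall (0 : ℂ × ℂ) R₂, ‖m p‖ ≤ K := fun p hp =>
    (hK₂ p hp).trans ((le_max_right _ _).trans (le_max_right _ _))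
  set r : ℝ := min (R₂ / 2) (1 / (8 * K)) with hr_def
  have hr : 0 < r := lt_min (by positivity) (by positivity)
  have hr2 : 2 * r ≤ R₂ := by have := min_le_left (R₂ / 2) (1 / (8 * K)); linarith
  have hrK : 8 * r * K ≤ 1 := by
    have : r ≤ 1 / (8 * K) := min_le_right _ _
    rw [le_div_iff₀ (by positivity)] at this
    linarith
  have hsub2 : Metric.ball (0 : ℂ × ℂ) (2 * r) ⊆ Metric.closedBall 0 R₂ :=
    (Metric.ball_subset_ball hr2).trans hbs
  have hW0 : 0 ≤ W := (norm_nonneg _).trans (hW 0 (Metric.mem_closedBall_self hR₂.le))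
  refine ⟨r / 2, by positivity, ?_, Real.log 2 * (r / (16 * K)),
    mul_pos (Real.log_pos one_lt_two) (by positivity), 2 * K + 3 / r + 4 * W * K, by positivity,
    r / (16 * K), by positivity, fun h hh0 hh => ?_⟩
  · have := hR₂'.trans_le (min_le_left _ _); linarith
  -- the largest number of steps for which each step still gains a factor `1 / 2`
  set N : ℕ := ⌊r / (16 * K * h)⌋₊ with hN_def
  have hN1 : 1 ≤ N := by
    rw [hN_def, Nat.one_le_floor_iff, le_div_iff₀ (by positivity)]
    rw [le_div_iff₀ (by positivity)] at hh
    linarith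
  have hNh : 16 * K * h * N ≤ r := by
    have : (N : ℝ) ≤ r / (16 * K * h) := Nat.floor_le (by positivity)
    rw [le_div_iff₀ (by positivity)] at this
    linarith
  have hN0 : (0 : ℝ) < N := by exact_mod_cast hN1
  have hterm : ∀ j ≤ N, ∀ p ∈ Metric.ball (0 : ℂ × ℂ) r,
      ‖amplitudeTerm k m h j p‖ ≤ K / 2 ^ j := by
    intro j hj p hp
    refine norm_amplitudeTerm_le hk hm hr hr2 hh0.le hN1 hK0.le (fun p hp => hkK p (hsub2 hp))
      (fun p hp => hmK p (hsub2 hp)) hrK hNh j hj p (Metric.ball_subset_ball ?_ hp)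
    have hjN : (j : ℝ) ≤ N := by exact_mod_cast hj
    have : (j : ℝ) * (r / N) ≤ r := by
      rw [mul_div_assoc', div_le_iff₀ hN0]
      nlinarith
    linarith
  have hgeom : ∑ j ∈ Finset.range N, K / 2 ^ j ≤ 2 * K := by
    have h1 : ∑ j ∈ Finset.range N, ((1 : ℝ) / 2) ^ j ≤ 2 := by
      have := Summable.sum_le_tsum (Finset.range N) (fun j _ => by positivity)
        (summable_geometric_two)
      rwa [tsum_geometric_two] at this
    calc ∑ j ∈ Finset.range N, K / 2 ^ j = K * ∑ j ∈ Finset.range N, ((1 : ℝ) / 2) ^ j := by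
          rw [Finset.mul_sum]
          refine Finset.sum_congr rfl fun j _ => ?_
          rw [one_div, inv_pow, div_eq_mul_inv]
      _ ≤ K * 2 := by gcongr
      _ = 2 * K := mul_comm _ _
  have hv1 : ∀ p ∈ Metric.ball (0 : ℂ × ℂ) r, ‖amplitude k m h N p - 1‖ ≤ 1 / 2 := by
    intro p hp
    have hpr : ‖p.2‖ ≤ r := (norm_snd_le p).trans (mem_ball_zero_iff.1 hp).le
    rw [amplitude, add_sub_cancel_left]
    calc ‖∑ j ∈ Finset.range N, primSnd (amplitudeTerm k m h j) p‖
        ≤ ∑ j ∈ Finset.range N, r * (K / 2 ^ j) := by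
          refine norm_sum_le_of_le _ fun j hj => ?_
          refine (norm_primSnd_le fun t ht => hterm j (Finset.mem_range.1 hj).le _
            (scaleSnd_mem_ball ht hp)).trans ?_
          exact mul_le_mul_of_nonneg_right hpr (by positivity)
      _ = r * ∑ j ∈ Finset.range N, K / 2 ^ j := by rw [Finset.mul_sum]
      _ ≤ r * (2 * K) := by gcongr
      _ ≤ 1 / 2 := by nlinarith
  have hv2 : ∀ p ∈ Metric.ball (0 : ℂ × ℂ) r, ‖amplitude k m h N p‖ ≤ 3 / 2 := by
    intro p hp
    have h1 := hv1 p hp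
    have h2 := norm_add_le (amplitude k m h N p - 1) 1
    rw [sub_add_cancel, norm_one] at h2
    linarith
  have hbig : Metric.ball (0 : ℂ × ℂ) r ⊆ Metric.ball 0 R₂ :=
    Metric.ball_subset_ball (by linarith)
  have hhalf : Metric.ball (0 : ℂ × ℂ) (r / 2) ⊆ Metric.ball 0 r :=
    Metric.ball_subset_ball (by linarith)
  refine ⟨amplitude k m h N, (contDiffOn_amplitude hk hm N).mono (hhalf.trans hbig),
    fun p hp => ?_⟩
  have hpr := hhalf hp
  have hpR := hbig hpr
  have hpos : 0 ≤ 3 / r := by positivity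
  have hpos' : 0 ≤ 4 * W * K := by positivity
  refine ⟨hv1 p hpr, ?_, ?_, ?_⟩
  · have : ‖dFst (amplitude k m h N) p‖ ≤ 3 / 2 / (r / 2) :=
      norm_dFst_le (R := R₂) (by positivity) (by linarith) (contDiffOn_amplitude hk hm N)
        (fun q hq => hv2 q (by rwa [add_halves] at hq)) hp
    have e : 3 / 2 / (r / 2) = 3 / r := by field_simp
    rw [e] at this
    linarith
  · rw [dSnd_amplitude hk hm N hpR]
    have := norm_sum_le_of_le (Finset.range N) fun j hj =>
      hterm j (Finset.mem_range.1 hj).le p hpr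
    linarith
  · have heq : -4 * (h : ℂ) * dFst (dSnd (amplitude k m h N)) p +
        2 * Complex.I * w p * dSnd (amplitude k m h N) p + (G p - μ) * amplitude k m h N p =
        2 * Complex.I * w p * (-amplitudeTerm k m h N p) := by
      rw [← amplitude_equation hk hm N hpR]
      have hne := h2iw p (hbs hpR)
      have hkp : 2 * Complex.I * w p * k p = 1 := mul_inv_cancel₀ hne
      have hmp : 2 * Complex.I * w p * m p = G p - μ := by
        rw [hm_def]
        linear_combination (G p - μ) * hkp
      linear_combination (4 * (h : ℂ) * dFst (dSnd (amplitude k m h N)) p) * hkp -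
        amplitude k m h N p * hmp
    rw [heq, norm_mul, norm_neg]
    have hn : ‖2 * Complex.I * w p‖ ≤ 2 * W := by
      rw [norm_mul, norm_mul, Complex.norm_I]
      simpa using hW p (hbs hpR)
    have hexp : (1 : ℝ) / 2 ^ N ≤ 2 * Real.exp (-(Real.log 2 * (r / (16 * K))) / h) := by
      have hlt : r / (16 * K * h) < N + 1 := Nat.lt_floor_add_one _
      have h2N : (2 : ℝ) ^ N = Real.exp (Real.log 2 * N) := by
        rw [mul_comm, Real.exp_nat_mul, Real.exp_log two_pos]
      have h2' : (2 : ℝ) = Real.exp (Real.log 2) := (Real.exp_log two_pos).symm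
      rw [h2N, one_div, ← Real.exp_neg]
      nth_rewrite 2 [h2']
      rw [← Real.exp_add]
      apply Real.exp_le_exp.2
      have e : -(Real.log 2 * (r / (16 * K))) / h = -(Real.log 2 * (r / (16 * K * h))) := by
        field_simp
      rw [e]
      nlinarith [Real.log_pos one_lt_two]
    calc ‖2 * Complex.I * w p‖ * ‖amplitudeTerm k m h N p‖
        ≤ (2 * W) * (K / 2 ^ N) := by
          gcongr
          exact hterm N le_rfl p hpr
      _ = (2 * W * K) * (1 / 2 ^ N) := by ring
      _ ≤ (2 * W * K) * (2 * Real.exp (-(Real.log 2 * (r / (16 * K))) / h)) := by gcongr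
      _ = (4 * W * K) * Real.exp (-(Real.log 2 * (r / (16 * K))) / h) := by ring
      _ ≤ _ := by
          gcongr
          linarith

/-! ### The magnetic Laplacian on test functions -/

/-- The momentum `(-ih ∂_j - A_j) u`, with the classical derivative. -/
noncomputable def momentum (h : ℝ) (A : Plane → Fin 2 → ℂ) (j : Fin 2) (u : Plane → ℂ)
    (x : Plane) : ℂ :=
  -(Complex.I * (h : ℂ)) * partialDeriv j u x - A x j * u x

/-- The differential expression `(-ih∇ - A)² u`, with classical derivatives. -/
noncomputable def classicalLaplacian (h : ℝ) (A : Plane → Fin 2 → ℂ) (u : Plane → ℂ)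
    (x : Plane) : ℂ :=
  ∑ j, momentum h A j (momentum h A j u) x

theorem HasFDerivAt.partialDeriv {F : Type*} [NormedAddCommGroup F] [NormedSpace ℝ F]
    {f : Plane → F} {f' : Plane →L[ℝ] F} {x : Plane} (hf : HasFDerivAt f f' x) (j : Fin 2) :
    partialDeriv j f x = f' (basisVec j) := by
  rw [_root_.partialDeriv, hf.fderiv]

theorem contDiff_component {A : Plane → Fin 2 → ℂ} (hA : ContDiff ℝ ∞ A) (j : Fin 2) :
    ContDiff ℝ ∞ fun x => A x j :=
  (contDiff_apply ℝ ℂ j).comp hA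

namespace IsTestFunction

variable {φ ψ : Plane → ℂ}

theorem partialDeriv (hφ : IsTestFunction φ) (j : Fin 2) : IsTestFunction (partialDeriv j φ) :=
  ⟨(hφ.1.fderiv_right (by simp)).clm_apply contDiff_const, hφ.2.fderiv_apply (𝕜 := ℝ) _⟩

theorem conjugate (hφ : IsTestFunction φ) : IsTestFunction fun x => conj (φ x) :=
  ⟨Complex.conjCLE.contDiff.comp hφ.1, hφ.2.comp_left (g := fun z : ℂ => conj z) (by simp)⟩

theorem smooth_mul {a : Plane → ℂ} (ha : ContDiff ℝ ∞ a) (hφ : IsTestFunction φ) :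
    IsTestFunction fun x => a x * φ x :=
  ⟨ha.mul hφ.1, hφ.2.mul_left⟩

theorem sub (hφ : IsTestFunction φ) (hψ : IsTestFunction ψ) : IsTestFunction fun x => φ x - ψ x :=
  ⟨hφ.1.sub hψ.1, hφ.2.sub hψ.2⟩

theorem momentum (h : ℝ) {A : Plane → Fin 2 → ℂ} (hA : ContDiff ℝ ∞ A) (j : Fin 2)
    (hφ : IsTestFunction φ) : IsTestFunction (momentum h A j φ) :=
  ((hφ.partialDeriv j).smooth_mul contDiff_const).sub (hφ.smooth_mul (contDiff_component hA j))

theorem classicalLaplacian (h : ℝ) {A : Plane → Fin 2 → ℂ} (hA : ContDiff ℝ ∞ A)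
    (hφ : IsTestFunction φ) : IsTestFunction (classicalLaplacian h A φ) := by
  have h0 := (hφ.momentum h hA 0).momentum h hA 0
  have h1 := (hφ.momentum h hA 1).momentum h hA 1
  have : _root_.classicalLaplacian h A φ = fun x =>
      _root_.momentum h A 0 (_root_.momentum h A 0 φ) x +
        _root_.momentum h A 1 (_root_.momentum h A 1 φ) x := by
    funext x
    rw [_root_.classicalLaplacian, Fin.sum_univ_two]
  rw [this]
  exact ⟨h0.1.add h1.1, h0.2.add h1.2⟩

theorem coeFn_toL2 (hφ : IsTestFunction φ) : (hφ.toL2 : Plane → ℂ) =ᵐ[volume] φ :=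
  hφ.memLp.coeFn_toLp

theorem integral_toL2_mul (hφ : IsTestFunction φ) (g : Plane → ℂ) :
    ∫ x, (hφ.toL2 : Plane → ℂ) x * g x = ∫ x, φ x * g x := by
  apply integral_congr_ae
  filter_upwards [hφ.coeFn_toL2] with x hx
  rw [hx]

end IsTestFunction

theorem contDiff_ofReal_re {A : Plane → Fin 2 → ℂ} (hA : ContDiff ℝ ∞ A) :
    ContDiff ℝ ∞ fun x j => ((A x j).re : ℂ) :=
  contDiff_pi.2 fun j => Complex.ofRealCLM.contDiff.comp
    (Complex.reCLM.contDiff.comp (contDiff_component hA j))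

theorem partialDeriv_conj {φ : Plane → ℂ} (hφ : IsTestFunction φ) (j : Fin 2) (x : Plane) :
    partialDeriv j (fun y => conj (φ y)) x = conj (partialDeriv j φ x) := by
  have h1 : HasFDerivAt φ (fderiv ℝ φ x) x := (hφ.1.differentiable (by simp) x).hasFDerivAt
  have h2 := Complex.conjCLE.toContinuousLinearMap.hasFDerivAt.comp x h1
  have h3 : HasFDerivAt (fun y => conj (φ y)) _ x := h2
  rw [h3.partialDeriv]
  rfl

/-- Integration by parts for test functions. -/
theorem integral_momentum_mul (h : ℝ) {A : Plane → Fin 2 → ℂ} (hA : ContDiff ℝ ∞ A) (j : Fin 2)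
    {χ φ : Plane → ℂ} (hχ : IsTestFunction χ) (hφ : IsTestFunction φ) :
    ∫ x, momentum h A j χ x * φ x =
      ∫ x, χ x * (Complex.I * (h : ℂ) * partialDeriv j φ x - A x j * φ x) := by
  have i1 : Integrable (fun x => partialDeriv j χ x * φ x) (volume : Measure Plane) :=
    ((hχ.partialDeriv j).1.continuous.mul hφ.1.continuous).integrable_of_hasCompactSupport
      hφ.2.mul_left
  have i2 : Integrable (fun x => χ x * partialDeriv j φ x) (volume : Measure Plane) :=
    (hχ.1.continuous.mul (hφ.partialDeriv j).1.continuous).integrable_of_hasCompactSupport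
      hχ.2.mul_right
  have i3 : Integrable (fun x => χ x * φ x) (volume : Measure Plane) :=
    (hχ.1.continuous.mul hφ.1.continuous).integrable_of_hasCompactSupport hχ.2.mul_right
  have i4 : Integrable (fun x => A x j * (χ x * φ x)) (volume : Measure Plane) :=
    ((contDiff_component hA j).continuous.mul
      (hχ.1.continuous.mul hφ.1.continuous)).integrable_of_hasCompactSupport
      hχ.2.mul_right.mul_left
  have ibp : ∫ x, χ x * partialDeriv j φ x = -∫ x, partialDeriv j χ x * φ x :=
    integral_mul_fderiv_eq_neg_fderiv_mul_of_integrable i1 i2 i3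
      (fun x _ => hχ.1.differentiable (by simp) x) (fun x _ => hφ.1.differentiable (by simp) x)
  have l : ∀ x, momentum h A j χ x * φ x =
      -(Complex.I * (h : ℂ)) * (partialDeriv j χ x * φ x) - A x j * (χ x * φ x) :=
    fun x => by rw [momentum]; ring
  have r : ∀ x, χ x * (Complex.I * (h : ℂ) * partialDeriv j φ x - A x j * φ x) =
      (Complex.I * (h : ℂ)) * (χ x * partialDeriv j φ x) - A x j * (χ x * φ x) :=
    fun x => by ring
  simp_rw [l, r]
  rw [integral_sub (i1.const_mul _) i4, integral_sub (i2.const_mul _) i4,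
    integral_const_mul, integral_const_mul, ibp]
  ring

theorem isMagneticGradient_toL2 (h : ℝ) {A : Plane → Fin 2 → ℂ} (hA : ContDiff ℝ ∞ A)
    {u : Plane → ℂ} (hu : IsTestFunction u) :
    IsMagneticGradient h A hu.toL2
      fun j => (hu.momentum h (contDiff_ofReal_re hA) j).toL2 := by
  intro j φ hφ
  rw [IsTestFunction.integral_toL2_mul, IsTestFunction.integral_toL2_mul]
  exact integral_momentum_mul h (contDiff_ofReal_re hA) j hu hφ

/-- On test functions, the operator is the differential expression `(-ih∇ - A)²`. -/
theorem isMagneticLaplacian_toL2 (h : ℝ) {A : Plane → Fin 2 → ℂ} (hA : ContDiff ℝ ∞ A)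
    {u : Plane → ℂ} (hu : IsTestFunction u) :
    IsMagneticLaplacian h A hu.toL2 (hu.classicalLaplacian h hA).toL2 := by
  refine ⟨hu.mem_formDomain h hA.continuous, fun v hv => ?_⟩
  obtain ⟨⟨g, hg⟩, hv2⟩ := hv
  have hre := contDiff_ofReal_re hA
  have hvL : MemLp (fun x => conj (v x)) 2 (volume : Measure Plane) := (Lp.memLp v).star
  have hint : ∀ {φ : Plane → ℂ} (_ : IsTestFunction φ),
      Integrable (fun x => φ x * conj (v x)) volume := fun hφ =>
    hφ.memLp.integrable_mul hvL
  have key : ∀ j, ∫ x, (magneticGradient h A hu.toL2 j x -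
      Complex.I * ((A x j).im : ℂ) * (hu.toL2 : Plane → ℂ) x) *
      conj (magneticGradient h A v j x + Complex.I * ((A x j).im : ℂ) * v x) =
      ∫ x, momentum h A j (momentum h A j u) x * conj (v x) := by
    intro j
    have hψ := hu.momentum h hA j
    set ψ := momentum h A j u with hψ_def
    rw [magneticGradient_eq (isMagneticGradient_toL2 h hA hu), magneticGradient_eq hg]
    have hgL : MemLp (fun x => conj (g j x)) 2 (volume : Measure Plane) := (Lp.memLp (g j)).star
    have havL : MemLp (fun x => conj (((A x j).im : ℂ) * v x)) 2 (volume : Measure Plane) :=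
      (hv2 j).star
    have i1 : Integrable (fun x => ψ x * conj (g j x)) (volume : Measure Plane) :=
      hψ.memLp.integrable_mul hgL
    have i2 : Integrable (fun x => ψ x * conj (((A x j).im : ℂ) * v x)) (volume : Measure Plane) :=
      hψ.memLp.integrable_mul havL
    have e1 : ∫ x, ((hu.momentum h hre j).toL2 x -
        Complex.I * ((A x j).im : ℂ) * (hu.toL2 : Plane → ℂ) x) *
        conj (g j x + Complex.I * ((A x j).im : ℂ) * v x) =
        ∫ x, (ψ x * conj (g j x) - Complex.I * (ψ x * conj (((A x j).im : ℂ) * v x))) := by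
      apply integral_congr_ae
      filter_upwards [hu.coeFn_toL2, (hu.momentum h hre j).coeFn_toL2] with x h1 h2
      have h3 : ψ x = momentum h (fun x j => ((A x j).re : ℂ)) j u x -
          Complex.I * ((A x j).im : ℂ) * u x := by
        rw [hψ_def, momentum, momentum]
        have := Complex.re_add_im (A x j)
        linear_combination (u x) * this
      rw [h1, h2, h3]
      simp only [map_add, map_mul, Complex.conj_I, Complex.conj_ofReal]
      ring
    have e2 : ∫ x, ψ x * conj (g j x) =
        ∫ x, momentum h (fun x j => ((A x j).re : ℂ)) j ψ x * conj (v x) := by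
      have h1 := congrArg conj (hg j _ hψ.conjugate)
      rw [← integral_conj, ← integral_conj] at h1
      simp only [map_mul, map_sub, Complex.conj_conj, Complex.conj_I, Complex.conj_ofReal,
        partialDeriv_conj hψ] at h1
      simp_rw [mul_comm (ψ _)]
      rw [h1]
      refine integral_congr_ae (Filter.Eventually.of_forall fun x => ?_)
      simp only [momentum]
      ring
    rw [e1, integral_sub i1 (i2.const_mul _), integral_const_mul, e2, ← integral_const_mul,
      ← integral_sub (hint (hψ.momentum h hre j)) (i2.const_mul _)]
    refine integral_congr_ae (Filter.Eventually.of_forall fun x => ?_)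
    have := Complex.re_add_im (A x j)
    simp only [momentum, map_mul, Complex.conj_ofReal]
    linear_combination (-ψ x * conj (v x)) * this
  rw [magneticForm]
  simp_rw [key]
  rw [Fin.sum_univ_two, IsTestFunction.integral_toL2_mul,
    ← integral_add (hint ((hu.momentum h hA 0).momentum h hA 0))
      (hint ((hu.momentum h hA 1).momentum h hA 1))]
  refine integral_congr_ae (Filter.Eventually.of_forall fun x => ?_)
  simp only [classicalLaplacian, Fin.sum_univ_two]
  ring

/-! ### Conjugation by a complex phase -/

section

variable {U : Set Plane} {u v : Plane → ℂ} {x : Plane}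

theorem ContDiffOn.hasFDerivAt_of_isOpen (hu : ContDiffOn ℝ ∞ u U) (hU : IsOpen U) (hx : x ∈ U) :
    HasFDerivAt u (fderiv ℝ u x) x :=
  ((hu.differentiableOn (by simp)).differentiableAt (hU.mem_nhds hx)).hasFDerivAt

theorem ContDiffOn.partialDeriv (hu : ContDiffOn ℝ ∞ u U) (hU : IsOpen U) (j : Fin 2) :
    ContDiffOn ℝ ∞ (partialDeriv j u) U :=
  (hu.fderiv_of_isOpen hU (by simp)).clm_apply contDiffOn_const

theorem partialDeriv_mul (hu : DifferentiableAt ℝ u x) (hv : DifferentiableAt ℝ v x) (j : Fin 2) :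
    partialDeriv j (fun y => u y * v y) x =
      partialDeriv j u x * v x + u x * partialDeriv j v x := by
  have h1 : HasFDerivAt (fun y => u y * v y) _ x := hu.hasFDerivAt.mul hv.hasFDerivAt
  rw [h1.partialDeriv]
  simp only [partialDeriv, add_apply, smul_apply, smul_eq_mul]
  ring

theorem partialDeriv_congr (h : u =ᶠ[nhds x] v) (j : Fin 2) :
    partialDeriv j u x = partialDeriv j v x := by
  rw [partialDeriv, h.fderiv_eq, partialDeriv]

theorem momentum_congr {h : ℝ} {A : Plane → Fin 2 → ℂ} (huv : u =ᶠ[nhds x] v) (j : Fin 2) :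
    momentum h A j u x = momentum h A j v x := by
  rw [momentum, momentum, partialDeriv_congr huv, huv.eq_of_nhds]

theorem contDiffOn_momentum {h : ℝ} {q : Plane → Fin 2 → ℂ} (hU : IsOpen U) {j : Fin 2}
    (hq : ContDiffOn ℝ ∞ (fun x => q x j) U) (hu : ContDiffOn ℝ ∞ u U) :
    ContDiffOn ℝ ∞ (momentum h q j u) U :=
  (contDiffOn_const.mul (hu.partialDeriv hU j)).sub (hq.mul hu)

/-- Conjugation by `e^{if/h}` replaces the potential `A` by `A - ∇f`. -/
theorem momentum_exp_mul {h : ℝ} (hh : h ≠ 0) {A q : Plane → Fin 2 → ℂ} {f : Plane → ℂ} {j : Fin 2}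
    (hf : DifferentiableAt ℝ f x) (hv : DifferentiableAt ℝ v x)
    (hfq : partialDeriv j f x = A x j - q x j) :
    momentum h A j (fun y => Complex.exp (Complex.I * f y / h) * v y) x =
      Complex.exp (Complex.I * f x / h) * momentum h q j v x := by
  have h1 : HasFDerivAt (fun y => Complex.I * f y / h) ((Complex.I / h) • fderiv ℝ f x) x := by
    have := hf.hasFDerivAt.const_mul (Complex.I / h)
    refine this.congr_of_eventuallyEq (Filter.Eventually.of_forall fun y => ?_)
    ring
  have h2 := h1.cexp
  have hhc : (h : ℂ) ≠ 0 := by exact_mod_cast hh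
  rw [momentum, partialDeriv_mul h2.differentiableAt hv, h2.partialDeriv, momentum]
  have h3 : fderiv ℝ f x (basisVec j) = A x j - q x j := hfq
  simp only [smul_apply, h3, smul_eq_mul]
  field_simp
  linear_combination (-(A x j - q x j) * v x) * Complex.I_sq

theorem classicalLaplacian_exp_mul {h : ℝ} (hh : h ≠ 0) (hU : IsOpen U) {A q : Plane → Fin 2 → ℂ}
    (hq : ∀ j, ContDiffOn ℝ ∞ (fun x => q x j) U) {f : Plane → ℂ} (hf : ContDiffOn ℝ ∞ f U)
    (hv : ContDiffOn ℝ ∞ v U) (hfq : ∀ y ∈ U, ∀ j, partialDeriv j f y = A y j - q y j)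
    (hx : x ∈ U) :
    classicalLaplacian h A (fun y => Complex.exp (Complex.I * f y / h) * v y) x =
      Complex.exp (Complex.I * f x / h) * classicalLaplacian h q v x := by
  rw [classicalLaplacian, classicalLaplacian, Finset.mul_sum]
  refine Finset.sum_congr rfl fun j _ => ?_
  have hev : momentum h A j (fun y => Complex.exp (Complex.I * f y / h) * v y) =ᶠ[nhds x]
      fun y => Complex.exp (Complex.I * f y / h) * momentum h q j v y := by
    filter_upwards [hU.mem_nhds hx] with y hy
    exact momentum_exp_mul hh (hf.hasFDerivAt_of_isOpen hU hy).differentiableAt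
      (hv.hasFDerivAt_of_isOpen hU hy).differentiableAt (hfq y hy j)
  rw [momentum_congr hev]
  exact momentum_exp_mul hh (hf.hasFDerivAt_of_isOpen hU hx).differentiableAt
    ((contDiffOn_momentum hU (hq j) hv).hasFDerivAt_of_isOpen hU hx).differentiableAt (hfq x hx j)

theorem momentum_momentum {h : ℝ} (hU : IsOpen U) {q : Plane → Fin 2 → ℂ} {j : Fin 2}
    (hq : ContDiffOn ℝ ∞ (fun x => q x j) U) (hv : ContDiffOn ℝ ∞ v U) (hx : x ∈ U) :
    momentum h q j (momentum h q j v) x =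
      -(h : ℂ) ^ 2 * partialDeriv j (partialDeriv j v) x +
        2 * Complex.I * h * q x j * partialDeriv j v x +
        Complex.I * h * partialDeriv j (fun y => q y j) x * v x + q x j ^ 2 * v x := by
  have hd := (hv.partialDeriv hU j).hasFDerivAt_of_isOpen hU hx
  have hv' := hv.hasFDerivAt_of_isOpen hU hx
  have hq' := hq.hasFDerivAt_of_isOpen hU hx
  have h1 : HasFDerivAt (momentum h q j v) _ x :=
    (hd.const_mul (-(Complex.I * (h : ℂ)))).sub (hq'.mul hv')
  rw [momentum, h1.partialDeriv, momentum]
  simp only [partialDeriv, sub_apply, smul_apply, add_apply, smul_eq_mul]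
  linear_combination ((h : ℂ) ^ 2 * fderiv ℝ (partialDeriv j v) x (basisVec j)) * Complex.I_sq

theorem partialDeriv_partialDeriv_mul (hU : IsOpen U) (hu : ContDiffOn ℝ ∞ u U)
    (hv : ContDiffOn ℝ ∞ v U) (hx : x ∈ U) (j : Fin 2) :
    partialDeriv j (partialDeriv j fun y => u y * v y) x =
      partialDeriv j (partialDeriv j u) x * v x + 2 * partialDeriv j u x * partialDeriv j v x +
        u x * partialDeriv j (partialDeriv j v) x := by
  have hd : ∀ {g : Plane → ℂ}, ContDiffOn ℝ ∞ g U → ∀ y ∈ U, DifferentiableAt ℝ g y :=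
    fun hg y hy => (hg.hasFDerivAt_of_isOpen hU hy).differentiableAt
  have hev : (partialDeriv j fun y => u y * v y) =ᶠ[nhds x]
      fun y => partialDeriv j u y * v y + u y * partialDeriv j v y := by
    filter_upwards [hU.mem_nhds hx] with y hy
    exact partialDeriv_mul (hd hu y hy) (hd hv y hy) j
  have hu' := hu.partialDeriv hU j
  have hv' := hv.partialDeriv hU j
  have hsum : ∀ {a b : Plane → ℂ}, DifferentiableAt ℝ a x → DifferentiableAt ℝ b x →
      partialDeriv j (fun y => a y + b y) x = partialDeriv j a x + partialDeriv j b x := by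
    intro a b ha hb
    have h1 : HasFDerivAt (fun y => a y + b y) _ x := ha.hasFDerivAt.add hb.hasFDerivAt
    rw [h1.partialDeriv]
    rfl
  rw [partialDeriv_congr hev, hsum (a := fun y => partialDeriv j u y * v y)
    (b := fun y => u y * partialDeriv j v y) ((hd hu' x hx).mul (hd hv x hx))
    ((hd hu x hx).mul (hd hv' x hx)), partialDeriv_mul (hd hu' x hx) (hd hv x hx),
    partialDeriv_mul (hd hu x hx) (hd hv' x hx)]
  ring

end

section

variable {G : ℂ × ℂ → ℂ} {R : ℝ} {x₁ x : Plane}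

theorem diagEmb_basisVec_zero : diagEmb (basisVec 0) = (1, 1) := by
  simp [diagEmb_apply, basisVec]

theorem diagEmb_basisVec_one : diagEmb (basisVec 1) = (Complex.I, -Complex.I) := by
  simp [diagEmb_apply, basisVec]

theorem diagEmb_sub_mem_ball (hx : x ∈ Metric.ball x₁ R) :
    diagEmb (x - x₁) ∈ Metric.ball (0 : ℂ × ℂ) R := by
  rw [mem_ball_zero_iff, norm_diagEmb, ← dist_eq_norm]
  exact hx

theorem hasFDerivAt_comp_diagEmb (hG : DifferentiableAt ℂ G (diagEmb (x - x₁))) :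
    HasFDerivAt (fun y => G (diagEmb (y - x₁)))
      (((fderiv ℂ G (diagEmb (x - x₁))).restrictScalars ℝ).comp diagEmb) x := by
  have h0 : HasFDerivAt (fun y : Plane => y - x₁) (ContinuousLinearMap.id ℝ Plane) x :=
    (hasFDerivAt_id x).sub_const x₁
  have h1 := diagEmb.hasFDerivAt.comp x h0
  rw [ContinuousLinearMap.comp_id] at h1
  exact (hG.hasFDerivAt.restrictScalars ℝ).comp x h1

theorem partialDeriv_zero_comp_diagEmb (hG : DifferentiableAt ℂ G (diagEmb (x - x₁))) :
    partialDeriv 0 (fun y => G (diagEmb (y - x₁))) x =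
      dFst G (diagEmb (x - x₁)) + dSnd G (diagEmb (x - x₁)) := by
  rw [(hasFDerivAt_comp_diagEmb hG).partialDeriv]
  simp only [ContinuousLinearMap.comp_apply, diagEmb_basisVec_zero,
    ContinuousLinearMap.coe_restrictScalars']
  have : ((1 : ℂ), (1 : ℂ)) = (1, 0) + (0, 1) := by simp
  rw [this, map_add]
  rfl

theorem partialDeriv_one_comp_diagEmb (hG : DifferentiableAt ℂ G (diagEmb (x - x₁))) :
    partialDeriv 1 (fun y => G (diagEmb (y - x₁))) x =
      Complex.I * (dFst G (diagEmb (x - x₁)) - dSnd G (diagEmb (x - x₁))) := by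
  rw [(hasFDerivAt_comp_diagEmb hG).partialDeriv]
  simp only [ContinuousLinearMap.comp_apply, diagEmb_basisVec_one,
    ContinuousLinearMap.coe_restrictScalars']
  have : (Complex.I, -Complex.I) = Complex.I • ((1 : ℂ), (0 : ℂ)) - Complex.I • (0, 1) := by simp
  rw [this, map_sub, map_smul, map_smul, smul_eq_mul, smul_eq_mul, mul_sub]
  rfl

theorem contDiffOn_comp_diagEmb (hG : ContDiffOn ℂ ∞ G (Metric.ball 0 R)) :
    ContDiffOn ℝ ∞ (fun y => G (diagEmb (y - x₁))) (Metric.ball x₁ R) := by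
  refine (hG.restrict_scalars ℝ).comp (diagEmb.contDiff.comp
    (contDiff_id.sub contDiff_const)).contDiffOn fun y hy => diagEmb_sub_mem_ball hy

theorem dFst_dSnd_comm (hG : ContDiffOn ℂ ∞ G (Metric.ball 0 R)) {p : ℂ × ℂ}
    (hp : p ∈ Metric.ball (0 : ℂ × ℂ) R) : dFst (dSnd G) p = dSnd (dFst G) p := by
  have hat : ContDiffAt ℂ ∞ G p := hG.contDiffAt (Metric.isOpen_ball.mem_nhds hp)
  have hsymm : IsSymmSndFDerivAt ℂ G p := hat.isSymmSndFDerivAt (by simp; exact WithTop.coe_le_coe.2 (le_top : (2 : ℕ∞) ≤ ⊤))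
  have hd : DifferentiableAt ℂ (fderiv ℂ G) p :=
    (hat.fderiv_right (m := ∞) (by simp)).differentiableAt (by simp)
  have e : ∀ a b : ℂ × ℂ, fderiv ℂ (fun q => fderiv ℂ G q a) p b =
      fderiv ℂ (fderiv ℂ G) p b a := by
    intro a b
    rw [fderiv_clm_apply hd (differentiableAt_const a)]
    simp
  change fderiv ℂ (fun q => fderiv ℂ G q (0, 1)) p (1, 0) =
    fderiv ℂ (fun q => fderiv ℂ G q (1, 0)) p (0, 1)
  rw [e, e]
  exact hsymm _ _

/-- On the trace of a holomorphic function, the Laplacian is `4 ∂_z ∂_ζ`. -/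
theorem laplacian_comp_diagEmb (hG : ContDiffOn ℂ ∞ G (Metric.ball 0 R))
    (hx : x ∈ Metric.ball x₁ R) :
    partialDeriv 0 (partialDeriv 0 fun y => G (diagEmb (y - x₁))) x +
      partialDeriv 1 (partialDeriv 1 fun y => G (diagEmb (y - x₁))) x =
      4 * dFst (dSnd G) (diagEmb (x - x₁)) := by
  have hp := diagEmb_sub_mem_ball hx
  have hd : ∀ {g : ℂ × ℂ → ℂ}, ContDiffOn ℂ ∞ g (Metric.ball 0 R) → ∀ y ∈ Metric.ball x₁ R,
      DifferentiableAt ℂ g (diagEmb (y - x₁)) :=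
    fun hg y hy => hg.differentiableAt_ball (diagEmb_sub_mem_ball hy)
  have hF := contDiffOn_dFst hG
  have hS := contDiffOn_dSnd hG
  have ev0 : (partialDeriv 0 fun y => G (diagEmb (y - x₁))) =ᶠ[nhds x]
      fun y => (fun p => dFst G p + dSnd G p) (diagEmb (y - x₁)) := by
    filter_upwards [Metric.isOpen_ball.mem_nhds hx] with y hy
    exact partialDeriv_zero_comp_diagEmb (hd hG y hy)
  have ev1 : (partialDeriv 1 fun y => G (diagEmb (y - x₁))) =ᶠ[nhds x]
      fun y => (fun p => Complex.I * (dFst G p - dSnd G p)) (diagEmb (y - x₁)) := by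
    filter_upwards [Metric.isOpen_ball.mem_nhds hx] with y hy
    exact partialDeriv_one_comp_diagEmb (hd hG y hy)
  rw [partialDeriv_congr ev0, partialDeriv_congr ev1,
    partialDeriv_zero_comp_diagEmb (hd (hF.add hS) x hx),
    partialDeriv_one_comp_diagEmb (hd (contDiffOn_const.mul (hF.sub hS)) x hx)]
  have hdF := (hd hF x hx).hasFDerivAt
  have hdS := (hd hS x hx).hasFDerivAt
  have e0 := (hdF.add hdS).fderiv
  have e1 := ((hdF.sub hdS).const_mul Complex.I).fderiv
  have hc := dFst_dSnd_comm hG hp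
  simp only [dFst, dSnd, Pi.add_def, Pi.sub_def] at e0 e1 hc ⊢
  rw [e0, e1]
  simp only [add_apply, sub_apply, smul_apply, smul_eq_mul]
  linear_combination (fderiv ℂ (dFst G) (diagEmb (x - x₁)) (1, 0) -
    fderiv ℂ (dSnd G) (diagEmb (x - x₁)) (1, 0) - fderiv ℂ (dFst G) (diagEmb (x - x₁)) (0, 1) +
    fderiv ℂ (dSnd G) (diagEmb (x - x₁)) (0, 1)) * Complex.I_sq - 2 * hc

end

/-- The isotropic potential `(w / 2) (1, i)`. -/
noncomputable def isotropicPotential (w : Plane → ℂ) (x : Plane) (j : Fin 2) : ℂ :=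
  if j = 0 then w x / 2 else Complex.I * w x / 2

/-- The error terms created by a cutoff function `χ` in `(-ih∇ - q)² (χ v)`, where `q` is the
isotropic potential of `w`. -/
noncomputable def cutoffError (h : ℝ) (w v χ : Plane → ℂ) (x : Plane) : ℂ :=
  -(h : ℂ) ^ 2 * (2 * (partialDeriv 0 χ x * partialDeriv 0 v x +
      partialDeriv 1 χ x * partialDeriv 1 v x) +
    (partialDeriv 0 (partialDeriv 0 χ) x + partialDeriv 1 (partialDeriv 1 χ) x) * v x) +
    Complex.I * h * w x * v x * (partialDeriv 0 χ x + Complex.I * partialDeriv 1 χ x)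

/-- As `1² + i² = 0`, the square of the isotropic potential does not contribute. -/
theorem classicalLaplacian_isotropicPotential {U : Set Plane} (hU : IsOpen U) {h : ℝ}
    {w v χ : Plane → ℂ} (hw : ContDiffOn ℝ ∞ w U) (hv : ContDiffOn ℝ ∞ v U)
    (hχ : ContDiffOn ℝ ∞ χ U) {x : Plane} (hx : x ∈ U) :
    classicalLaplacian h (isotropicPotential w) (fun y => χ y * v y) x =
      χ x * (-(h : ℂ) ^ 2 * (partialDeriv 0 (partialDeriv 0 v) x +
          partialDeriv 1 (partialDeriv 1 v) x) +
        Complex.I * h * w x * (partialDeriv 0 v x + Complex.I * partialDeriv 1 v x) +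
        Complex.I * h / 2 * (partialDeriv 0 w x + Complex.I * partialDeriv 1 w x) * v x) +
      cutoffError h w v χ x := by
  have hq0 : ContDiffOn ℝ ∞ (fun x => isotropicPotential w x 0) U := by
    simpa [isotropicPotential] using hw.div_const 2
  have hq1 : ContDiffOn ℝ ∞ (fun x => isotropicPotential w x 1) U := by
    simpa [isotropicPotential] using (contDiffOn_const.mul hw).div_const 2
  have hχv : ContDiffOn ℝ ∞ (fun y => χ y * v y) U := hχ.mul hv
  have hw' := hw.hasFDerivAt_of_isOpen hU hx
  have d0 : partialDeriv 0 (fun y => isotropicPotential w y 0) x = partialDeriv 0 w x / 2 := by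
    have : (fun y => isotropicPotential w y 0) = fun y => (1 / 2 : ℂ) * w y := by
      funext y; simp [isotropicPotential]; ring
    rw [this, (hw'.const_mul (1 / 2 : ℂ)).partialDeriv]
    simp [partialDeriv]; ring
  have d1 : partialDeriv 1 (fun y => isotropicPotential w y 1) x =
      Complex.I * partialDeriv 1 w x / 2 := by
    have : (fun y => isotropicPotential w y 1) = fun y => (Complex.I / 2 : ℂ) * w y := by
      funext y; simp [isotropicPotential]; ring
    rw [this, (hw'.const_mul (Complex.I / 2 : ℂ)).partialDeriv]
    simp [partialDeriv]; ring
  have hdv := (hv.hasFDerivAt_of_isOpen hU hx).differentiableAt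
  have hdχ := (hχ.hasFDerivAt_of_isOpen hU hx).differentiableAt
  rw [classicalLaplacian, Fin.sum_univ_two, momentum_momentum hU hq0 hχv hx,
    momentum_momentum hU hq1 hχv hx, d0, d1, partialDeriv_partialDeriv_mul hU hχ hv hx,
    partialDeriv_partialDeriv_mul hU hχ hv hx, partialDeriv_mul hdχ hdv, partialDeriv_mul hdχ hdv,
    cutoffError]
  simp only [isotropicPotential, if_true, one_ne_zero, if_false]
  linear_combination (w x ^ 2 / 4 * χ x * v x) * Complex.I_sq

/-- The action of `(-ih∇ - A)²` on `e^{if/h} χ v`, when `∇f = A - (w / 2) (1, i)` and `w`, `v` are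
traces of holomorphic functions. -/
theorem classicalLaplacian_wkb {h : ℝ} (hh : h ≠ 0) {x₁ : Plane} {R : ℝ} {A : Plane → Fin 2 → ℂ}
    {f χ : Plane → ℂ} {w v : ℂ × ℂ → ℂ} (hw : ContDiffOn ℂ ∞ w (Metric.ball 0 R))
    (hv : ContDiffOn ℂ ∞ v (Metric.ball 0 R)) (hf : ContDiffOn ℝ ∞ f (Metric.ball x₁ R))
    (hχ : ContDiff ℝ ∞ χ)
    (hfq : ∀ y ∈ Metric.ball x₁ R, ∀ j, partialDeriv j f y =
      A y j - isotropicPotential (fun y => w (diagEmb (y - x₁))) y j)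
    {x : Plane} (hx : x ∈ Metric.ball x₁ R) :
    classicalLaplacian h A (fun y => Complex.exp (Complex.I * f y / h) *
        (χ y * v (diagEmb (y - x₁)))) x =
      Complex.exp (Complex.I * f x / h) *
        (χ x * (h * (-4 * h * dFst (dSnd v) (diagEmb (x - x₁)) +
          2 * Complex.I * w (diagEmb (x - x₁)) * dSnd v (diagEmb (x - x₁)) +
          Complex.I * dSnd w (diagEmb (x - x₁)) * v (diagEmb (x - x₁)))) +
        cutoffError h (fun y => w (diagEmb (y - x₁))) (fun y => v (diagEmb (y - x₁))) χ x) := by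
  have hU : IsOpen (Metric.ball x₁ R) := Metric.isOpen_ball
  have hw' := contDiffOn_comp_diagEmb (x₁ := x₁) hw
  have hv' := contDiffOn_comp_diagEmb (x₁ := x₁) hv
  have hp := diagEmb_sub_mem_ball hx
  have hq : ∀ j, ContDiffOn ℝ ∞
      (fun x => isotropicPotential (fun y => w (diagEmb (y - x₁))) x j) (Metric.ball x₁ R) := by
    intro j
    unfold isotropicPotential
    split_ifs
    · exact hw'.div_const 2
    · exact (contDiffOn_const.mul hw').div_const 2
  rw [classicalLaplacian_exp_mul hh hU hq hf (hχ.contDiffOn.mul hv') hfq hx,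
    classicalLaplacian_isotropicPotential hU hw' hv' hχ.contDiffOn hx,
    laplacian_comp_diagEmb hv hx, partialDeriv_zero_comp_diagEmb (hv.differentiableAt_ball hp),
    partialDeriv_one_comp_diagEmb (hv.differentiableAt_ball hp),
    partialDeriv_zero_comp_diagEmb (hw.differentiableAt_ball hp),
    partialDeriv_one_comp_diagEmb (hw.differentiableAt_ball hp)]
  congr 2
  linear_combination (χ x * Complex.I * h * w (diagEmb (x - x₁)) *
    (dFst v (diagEmb (x - x₁)) - dSnd v (diagEmb (x - x₁))) + χ x * Complex.I * h / 2 *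
    (dFst w (diagEmb (x - x₁)) - dSnd w (diagEmb (x - x₁))) * v (diagEmb (x - x₁))) * Complex.I_sq

/-! ### The phase -/

/-- The real-linear form `c₁ dx₁ + c₂ dx₂`. -/
noncomputable def linForm (c : Fin 2 → ℂ) : Plane →L[ℝ] ℂ :=
  ∑ j, (EuclideanSpace.proj j : Plane →L[ℝ] ℝ).smulRight (c j)

theorem linForm_apply (c : Fin 2 → ℂ) (y : Plane) : linForm c y = (y 0 : ℂ) * c 0 + y 1 * c 1 := by
  simp [linForm]

theorem linForm_basisVec (c : Fin 2 → ℂ) (j : Fin 2) : linForm c (basisVec j) = c j := by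
  rw [linForm_apply]
  fin_cases j <;> simp [basisVec]

theorem clm_apply_eq {F : Type*} [NormedAddCommGroup F] [NormedSpace ℝ F] (L : Plane →L[ℝ] F)
    (y : Plane) : L y = y 0 • L (basisVec 0) + y 1 • L (basisVec 1) := by
  conv_lhs => rw [← sum_smul_basisVec y]
  rw [Fin.sum_univ_two, map_add, map_smul, map_smul]

/-- The Poincaré lemma on a disc, with a smooth primitive. -/
theorem exists_primitive_of_closed {F : Plane → Fin 2 → ℂ} {x₁ : Plane} {R : ℝ}
    (hF : ∀ j, ContDiffOn ℝ ∞ (fun x => F x j) (Metric.ball x₁ R))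
    (hclosed : ∀ x ∈ Metric.ball x₁ R,
      partialDeriv 0 (fun y => F y 1) x = partialDeriv 1 (fun y => F y 0) x) :
    ∃ f : Plane → ℂ, f x₁ = 0 ∧ ContDiffOn ℝ ∞ f (Metric.ball x₁ R) ∧
      ∀ x ∈ Metric.ball x₁ R, HasFDerivAt f (linForm (F x)) x := by
  have hU : IsOpen (Metric.ball x₁ R) := Metric.isOpen_ball
  set θ : Plane → Plane →L[ℝ] ℂ := fun x => linForm (F x) with hθ
  have hθs : ContDiffOn ℝ ∞ θ (Metric.ball x₁ R) := by
    refine ContDiffOn.sum fun j _ => ?_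
    exact contDiffOn_const.smulRight (hF j)
  have hsymm : ∀ a ∈ Metric.ball x₁ R, ∀ x y, fderiv ℝ θ a x y = fderiv ℝ θ a y x := by
    intro a ha x y
    have hθd : DifferentiableAt ℝ θ a :=
      (hθs.differentiableOn (by simp)).differentiableAt (hU.mem_nhds ha)
    have e : ∀ x : Plane, ∀ j, fderiv ℝ θ a x (basisVec j) = fderiv ℝ (fun y => F y j) a x := by
      intro x j
      have h1 : (fun y => F y j) = fun y => θ y (basisVec j) := by
        funext y
        rw [hθ, linForm_basisVec]
      rw [h1, fderiv_clm_apply hθd (differentiableAt_const _)]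
      simp
    have hc := hclosed a ha
    simp only [partialDeriv] at hc
    rw [clm_apply_eq (fderiv ℝ θ a x) y, clm_apply_eq (fderiv ℝ θ a y) x, e, e, e, e,
      clm_apply_eq (fderiv ℝ (fun y => F y 0) a) x, clm_apply_eq (fderiv ℝ (fun y => F y 1) a) x,
      clm_apply_eq (fderiv ℝ (fun y => F y 0) a) y, clm_apply_eq (fderiv ℝ (fun y => F y 1) a) y,
      hc]
    module
  obtain ⟨f, hf⟩ := (convex_ball x₁ R).exists_forall_hasFDerivAt_of_fderiv_symmetric hU
    (hθs.differentiableOn (by simp)) hsymm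
  have hf' : ∀ x ∈ Metric.ball x₁ R, HasFDerivAt (fun y => f y - f x₁) (θ x) x :=
    fun x hx => (hf x hx).sub_const _
  refine ⟨fun y => f y - f x₁, sub_self _, ?_, hf'⟩
  rw [contDiffOn_infty_iff_fderiv_of_isOpen hU]
  exact ⟨fun x hx => (hf' x hx).differentiableAt.differentiableWithinAt,
    hθs.congr fun x hx => (hf' x hx).fderiv⟩

theorem quadratic_bounds_of_hasDerivAt {g g' : ℝ → ℝ} {a b : ℝ} (hg0 : g 0 = 0)
    (hg : ∀ t ∈ Icc (0 : ℝ) 1, HasDerivAt g (g' t) t)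
    (hg' : ∀ t ∈ Icc (0 : ℝ) 1, a * t ≤ g' t ∧ g' t ≤ b * t) : a / 2 ≤ g 1 ∧ g 1 ≤ b / 2 := by
  have hint : ∀ t ∈ interior (Icc (0 : ℝ) 1), t ∈ Icc (0 : ℝ) 1 := fun t ht => interior_subset ht
  have hsq : ∀ c t : ℝ, HasDerivAt (fun t : ℝ => c / 2 * t ^ 2) (c * t) t := by
    intro c t
    have := (hasDerivAt_pow 2 t).const_mul (c / 2)
    exact this.congr_deriv (by norm_num; ring)
  have h0 : (0 : ℝ) ∈ Icc (0 : ℝ) 1 := by simp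
  have h1 : (1 : ℝ) ∈ Icc (0 : ℝ) 1 := by simp
  constructor
  · have hm : MonotoneOn (fun t => g t - a / 2 * t ^ 2) (Icc 0 1) := by
      refine monotoneOn_of_hasDerivWithinAt_nonneg (convex_Icc 0 1) (f' := fun t => g' t - a * t)
        (fun t ht => ((hg t ht).sub (hsq a t)).continuousAt.continuousWithinAt)
        (fun t ht => ((hg t (hint t ht)).sub (hsq a t)).hasDerivWithinAt)
        fun t ht => sub_nonneg.2 (hg' t (hint t ht)).1
    have := hm h0 h1 zero_le_one
    simp only [hg0] at this
    linarith
  · have hm : MonotoneOn (fun t => b / 2 * t ^ 2 - g t) (Icc 0 1) := by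
      refine monotoneOn_of_hasDerivWithinAt_nonneg (convex_Icc 0 1) (f' := fun t => b * t - g' t)
        (fun t ht => ((hsq b t).sub (hg t ht)).continuousAt.continuousWithinAt)
        (fun t ht => ((hsq b t).sub (hg t (hint t ht))).hasDerivWithinAt)
        fun t ht => sub_nonneg.2 (hg' t (hint t ht)).2
    have := hm h0 h1 zero_le_one
    simp only [hg0] at this
    linarith

theorem norm_sq_plane (y : Plane) : ‖y‖ ^ 2 = y 0 ^ 2 + y 1 ^ 2 := by
  rw [EuclideanSpace.norm_sq_eq, Fin.sum_univ_two]
  simp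

/-- If `∇(Im f)` vanishes at `x₁` with derivative `λ Id`, `λ > 0`, then `Im f` is comparable
with `|x - x₁|²` near `x₁`. -/
theorem exists_quadratic_bounds {F : Plane → Fin 2 → ℂ} {f : Plane → ℂ} {x₁ : Plane} {R lam : ℝ}
    (hR : 0 < R) (hlam : 0 < lam) (hf0 : f x₁ = 0)
    (hf : ∀ x ∈ Metric.ball x₁ R, HasFDerivAt f (linForm (F x)) x)
    (hF0 : ∀ j, (F x₁ j).im = 0)
    (hF : ∀ j, HasFDerivAt (fun x => (F x j).im)
      (lam • (EuclideanSpace.proj j : Plane →L[ℝ] ℝ)) x₁) :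
    ∃ ρ > 0, ρ ≤ R ∧ ∀ x ∈ Metric.ball x₁ ρ,
      lam / 4 * ‖x - x₁‖ ^ 2 ≤ (f x).im ∧ (f x).im ≤ lam * ‖x - x₁‖ ^ 2 := by
  have hl : 0 < lam / 4 := by positivity
  have hev : ∀ᶠ x in nhds x₁, ∀ j, |(F x j).im - lam * (x - x₁) j| ≤ lam / 4 * ‖x - x₁‖ := by
    rw [Filter.eventually_all]
    intro j
    filter_upwards [(hF j).isLittleO.bound hl] with x hx
    simpa [hF0 j] using hx
  obtain ⟨ρ, hρ, hρ'⟩ := Metric.eventually_nhds_iff_ball.1 hev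
  refine ⟨min ρ R, lt_min hρ hR, min_le_right _ _, fun x hx => ?_⟩
  set y := x - x₁ with hy
  have hyn : ‖y‖ < min ρ R := by rw [hy, ← dist_eq_norm]; exact hx
  have hmem : ∀ t ∈ Icc (0 : ℝ) 1, x₁ + t • y ∈ Metric.ball x₁ (min ρ R) := by
    intro t ht
    rw [Metric.mem_ball, dist_eq_norm, add_sub_cancel_left, norm_smul, Real.norm_of_nonneg ht.1]
    exact (mul_le_of_le_one_left (norm_nonneg _) ht.2).trans_lt hyn
  have hder : ∀ t ∈ Icc (0 : ℝ) 1, HasDerivAt (fun t : ℝ => (f (x₁ + t • y)).im)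
      (y 0 * (F (x₁ + t • y) 0).im + y 1 * (F (x₁ + t • y) 1).im) t := by
    intro t ht
    have h1 : HasDerivAt (fun t : ℝ => x₁ + t • y) y t := by
      simpa using ((hasDerivAt_id t).smul_const y).const_add x₁
    have h2 := (hf _ (Metric.ball_subset_ball (min_le_right _ _) (hmem t ht))).comp_hasDerivAt t h1
    have h3 := Complex.imCLM.hasFDerivAt.comp_hasDerivAt t h2
    refine h3.congr_deriv ?_
    rw [linForm_apply]
    simp
  have hbd : ∀ t ∈ Icc (0 : ℝ) 1,
      (lam / 2 * ‖y‖ ^ 2) * t ≤ y 0 * (F (x₁ + t • y) 0).im + y 1 * (F (x₁ + t • y) 1).im ∧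
      y 0 * (F (x₁ + t • y) 0).im + y 1 * (F (x₁ + t • y) 1).im ≤ (2 * lam * ‖y‖ ^ 2) * t := by
    intro t ht
    have hb := hρ' _ (Metric.ball_subset_ball (min_le_left _ _) (hmem t ht))
    simp only [add_sub_cancel_left, norm_smul, Real.norm_of_nonneg ht.1, PiLp.smul_apply,
      smul_eq_mul] at hb
    have hcoord : ∀ j, |y j| ≤ ‖y‖ := fun j => by
      simpa using PiLp.norm_apply_le y j
    have hprod : ∀ j, |y j * ((F (x₁ + t • y) j).im - lam * (t * y j))| ≤
        lam / 4 * ‖y‖ ^ 2 * t := by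
      intro j
      rw [abs_mul]
      calc |y j| * |(F (x₁ + t • y) j).im - lam * (t * y j)|
          ≤ ‖y‖ * (lam / 4 * (t * ‖y‖)) :=
            mul_le_mul (hcoord j) (hb j) (abs_nonneg _) (norm_nonneg _)
        _ = _ := by ring
    have p0 := abs_le.1 (hprod 0)
    have p1 := abs_le.1 (hprod 1)
    have hn := norm_sq_plane y
    have e : y 0 * (F (x₁ + t • y) 0).im + y 1 * (F (x₁ + t • y) 1).im =
        y 0 * ((F (x₁ + t • y) 0).im - lam * (t * y 0)) +
        y 1 * ((F (x₁ + t • y) 1).im - lam * (t * y 1)) + lam * ‖y‖ ^ 2 * t := by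
      rw [hn]; ring
    rw [e]
    have hpos : 0 ≤ lam * ‖y‖ ^ 2 * t := mul_nonneg (by positivity) ht.1
    constructor <;> linarith [p0.1, p0.2, p1.1, p1.2]
  have hx1 : x₁ + (1 : ℝ) • y = x := by rw [one_smul, hy]; abel
  have := quadratic_bounds_of_hasDerivAt (g := fun t : ℝ => (f (x₁ + t • y)).im) (by simp [hf0])
    hder hbd
  simp only [hx1] at this
  constructor <;> linarith [this.1, this.2]

theorem partialDeriv_im {g : Plane → ℂ} {x : Plane} (hg : DifferentiableAt ℝ g x) (j : Fin 2) :
    partialDeriv j (fun y => (g y).im) x = (partialDeriv j g x).im := by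
  have h1 : HasFDerivAt (fun y => (g y).im) _ x := Complex.imCLM.hasFDerivAt.comp x hg.hasFDerivAt
  rw [h1.partialDeriv]
  rfl

/-- The phase. The function `w` solves `i ∂_ζ w = B`, which makes `A - (w / 2) (1, i)` a closed
form; the remaining freedom, a function of `z`, is used to give `Im f` a critical point at `x₁`
with Hessian `(div Im A + Re B) / 2` times the identity. -/
theorem exists_phase {A : Plane → Fin 2 → ℂ} (hA : ContDiff ℝ ∞ A) {x₁ : Plane}
    (hne : ∃ j, (A x₁ j).im ≠ 0)
    (hpos : 0 < (magneticField A x₁).re + partialDeriv 0 (fun y => (A y 0).im) x₁ +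
      partialDeriv 1 (fun y => (A y 1).im) x₁)
    {R : ℝ} (hR : 0 < R) {G : ℂ × ℂ → ℂ} (hG : ContDiffOn ℂ ∞ G (Metric.ball 0 R))
    (hBG : ∀ y : Plane, ‖y‖ < R → magneticField A (x₁ + y) = G (diagEmb y)) :
    ∃ w : ℂ × ℂ → ℂ, ContDiffOn ℂ ∞ w (Metric.ball 0 R) ∧ w 0 ≠ 0 ∧
      (∀ p ∈ Metric.ball (0 : ℂ × ℂ) R, Complex.I * dSnd w p = G p) ∧
      ∃ f : Plane → ℂ, ContDiffOn ℝ ∞ f (Metric.ball x₁ R) ∧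
        (∀ y ∈ Metric.ball x₁ R, ∀ j, partialDeriv j f y =
          A y j - isotropicPotential (fun y => w (diagEmb (y - x₁))) y j) ∧
        ∃ ρ > 0, ρ ≤ R ∧ ∃ lam > 0, ∀ x ∈ Metric.ball x₁ ρ,
          lam / 4 * ‖x - x₁‖ ^ 2 ≤ (f x).im ∧ (f x).im ≤ lam * ‖x - x₁‖ ^ 2 := by
  have hAd : ∀ j x, DifferentiableAt ℝ (fun y => A y j) x := fun j x =>
    (contDiff_component hA j).differentiable (by simp) x
  rw [partialDeriv_im (hAd 0 x₁), partialDeriv_im (hAd 1 x₁)] at hpos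
  set B := magneticField A x₁ with hB
  have hB' : B = partialDeriv 0 (fun y => A y 1) x₁ - partialDeriv 1 (fun y => A y 0) x₁ := rfl
  set α : ℂ := 2 * ((A x₁ 1).im + (A x₁ 0).im * Complex.I) with hα
  set β : ℂ := ((partialDeriv 1 (fun y => A y 0) x₁).im +
      (partialDeriv 0 (fun y => A y 1) x₁).im : ℝ) +
    ((partialDeriv 0 (fun y => A y 0) x₁).im - (partialDeriv 1 (fun y => A y 1) x₁).im : ℝ) *
      Complex.I with hβ
  set w : ℂ × ℂ → ℂ := fun p => α + β * p.1 - Complex.I * primSnd G p with hw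
  have hws : ContDiffOn ℂ ∞ w (Metric.ball 0 R) :=
    (contDiffOn_const.add (contDiffOn_const.mul contDiff_fst.contDiffOn)).sub
      (contDiffOn_const.mul (contDiffOn_primSnd hG))
  have hwd : ∀ p ∈ Metric.ball (0 : ℂ × ℂ) R, HasFDerivAt w
      (β • ContinuousLinearMap.fst ℂ ℂ ℂ - Complex.I • fderiv ℂ (primSnd G) p) p := by
    intro p hp
    have h1 := ((contDiffOn_primSnd hG).differentiableAt_ball hp).hasFDerivAt.const_mul Complex.I
    have h2 := ((ContinuousLinearMap.fst ℂ ℂ ℂ).hasFDerivAt (x := p)).const_mul β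
    exact (h2.const_add α).sub h1
  have hwS : ∀ p ∈ Metric.ball (0 : ℂ × ℂ) R, Complex.I * dSnd w p = G p := by
    intro p hp
    have h1 := dSnd_primSnd hG hp
    rw [dSnd] at h1 ⊢
    rw [(hwd p hp).fderiv]
    simp only [sub_apply, smul_apply, ContinuousLinearMap.coe_fst', smul_eq_mul, mul_zero,
      zero_sub, h1]
    linear_combination (-G p) * Complex.I_sq
  have h0mem : (0 : ℂ × ℂ) ∈ Metric.ball (0 : ℂ × ℂ) R := Metric.mem_ball_self hR
  have hw0 : w 0 = α := by simp [hw, primSnd]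
  have hwF0 : dFst w 0 = β := by
    have h1 : dFst (primSnd G) 0 = 0 := by
      have h2 := hasDerivAt_slice_fst (z := 0) (ζ := 0)
        ((contDiffOn_primSnd hG).differentiableAt_ball h0mem)
      have h3 : (fun s : ℂ => primSnd G (s, 0)) = fun _ => 0 := by
        funext s; simp [primSnd]
      rw [h3] at h2
      exact h2.unique (hasDerivAt_const _ _)
    rw [dFst] at h1 ⊢
    rw [(hwd 0 h0mem).fderiv]
    simp only [sub_apply, smul_apply, ContinuousLinearMap.coe_fst', smul_eq_mul, h1]
    ring
  have hG0 : G 0 = B := by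
    have := hBG 0 (by simpa using hR)
    simpa using this.symm
  have hwS0 : dSnd w 0 = -Complex.I * B := by
    have := hwS 0 h0mem
    rw [hG0] at this
    linear_combination (-Complex.I) * this + dSnd w 0 * Complex.I_sq
  set W : Plane → ℂ := fun y => w (diagEmb (y - x₁)) with hW
  have hWs : ContDiffOn ℝ ∞ W (Metric.ball x₁ R) := contDiffOn_comp_diagEmb hws
  have hU : IsOpen (Metric.ball x₁ R) := Metric.isOpen_ball
  set F : Plane → Fin 2 → ℂ := fun y j => A y j - isotropicPotential W y j with hF
  have hF0eq : (fun y => F y 0) = fun y => A y 0 - (1 / 2 : ℂ) * W y := by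
    funext y; simp [hF, isotropicPotential]; ring
  have hF1eq : (fun y => F y 1) = fun y => A y 1 - (Complex.I / 2) * W y := by
    funext y; simp [hF, isotropicPotential]; ring
  have hFs : ∀ j, ContDiffOn ℝ ∞ (fun x => F x j) (Metric.ball x₁ R) := by
    intro j
    fin_cases j
    · change ContDiffOn ℝ ∞ (fun x => F x 0) (Metric.ball x₁ R)
      rw [hF0eq]
      exact (contDiff_component hA 0).contDiffOn.sub (contDiffOn_const.mul hWs)
    · change ContDiffOn ℝ ∞ (fun x => F x 1) (Metric.ball x₁ R)
      rw [hF1eq]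
      exact (contDiff_component hA 1).contDiffOn.sub (contDiffOn_const.mul hWs)
  have hFp0 : ∀ x ∈ Metric.ball x₁ R, ∀ i, partialDeriv i (fun y => F y 0) x =
      partialDeriv i (fun y => A y 0) x - (1 / 2 : ℂ) * partialDeriv i W x := by
    intro x hx i
    have h1 : HasFDerivAt (fun y => A y 0 - (1 / 2 : ℂ) * W y) _ x :=
      (hAd 0 x).hasFDerivAt.sub ((hWs.hasFDerivAt_of_isOpen hU hx).const_mul (1 / 2 : ℂ))
    rw [hF0eq, h1.partialDeriv]
    rfl
  have hFp1 : ∀ x ∈ Metric.ball x₁ R, ∀ i, partialDeriv i (fun y => F y 1) x =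
      partialDeriv i (fun y => A y 1) x - (Complex.I / 2) * partialDeriv i W x := by
    intro x hx i
    have h1 : HasFDerivAt (fun y => A y 1 - (Complex.I / 2) * W y) _ x :=
      (hAd 1 x).hasFDerivAt.sub ((hWs.hasFDerivAt_of_isOpen hU hx).const_mul (Complex.I / 2))
    rw [hF1eq, h1.partialDeriv]
    rfl
  have hW0 : ∀ x ∈ Metric.ball x₁ R, partialDeriv 0 W x =
      dFst w (diagEmb (x - x₁)) + dSnd w (diagEmb (x - x₁)) := fun x hx =>
    partialDeriv_zero_comp_diagEmb (hws.differentiableAt_ball (diagEmb_sub_mem_ball hx))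
  have hW1 : ∀ x ∈ Metric.ball x₁ R, partialDeriv 1 W x =
      Complex.I * (dFst w (diagEmb (x - x₁)) - dSnd w (diagEmb (x - x₁))) := fun x hx =>
    partialDeriv_one_comp_diagEmb (hws.differentiableAt_ball (diagEmb_sub_mem_ball hx))
  have hclosed : ∀ x ∈ Metric.ball x₁ R,
      partialDeriv 0 (fun y => F y 1) x = partialDeriv 1 (fun y => F y 0) x := by
    intro x hx
    have hxn : ‖x - x₁‖ < R := by rw [← dist_eq_norm]; exact hx
    have h1 := hBG (x - x₁) hxn
    rw [add_sub_cancel, ← hwS _ (diagEmb_sub_mem_ball hx), magneticField] at h1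
    rw [hFp0 x hx, hFp1 x hx, hW0 x hx, hW1 x hx]
    linear_combination h1
  obtain ⟨f, hf0, hfs, hfd⟩ := exists_primitive_of_closed hFs hclosed
  have hx₁ : x₁ ∈ Metric.ball x₁ R := Metric.mem_ball_self hR
  have hdiag0 : diagEmb (x₁ - x₁) = 0 := by simp
  have hWx : W x₁ = α := by rw [hW]; simp only [hdiag0, hw0]
  set lam : ℝ := (B.re + (partialDeriv 0 (fun y => A y 0) x₁).im +
    (partialDeriv 1 (fun y => A y 1) x₁).im) / 2 with hlam
  have hF00 : ∀ j, (F x₁ j).im = 0 := by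
    intro j
    fin_cases j
    · change ((fun y => F y 0) x₁).im = 0
      rw [hF0eq]
      simp only [hWx, hα]
      simp
    · change ((fun y => F y 1) x₁).im = 0
      rw [hF1eq]
      simp only [hWx, hα]
      simp
  have hF' : ∀ j, HasFDerivAt (fun x => (F x j).im)
      (lam • (EuclideanSpace.proj j : Plane →L[ℝ] ℝ)) x₁ := by
    intro j
    have h1 := Complex.imCLM.hasFDerivAt.comp x₁ ((hFs j).hasFDerivAt_of_isOpen hU hx₁)
    refine h1.congr_fderiv ?_
    ext y
    have hp0 := hFp0 x₁ hx₁
    have hp1 := hFp1 x₁ hx₁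
    have hWp0 := hW0 x₁ hx₁
    have hWp1 := hW1 x₁ hx₁
    rw [hdiag0, hwF0, hwS0] at hWp0 hWp1
    have hBim := congrArg Complex.im hB'
    simp only [Complex.sub_im] at hBim
    have hp : ∀ i j, (fderiv ℝ (fun y => F y j) x₁ (basisVec i)).im = if i = j then lam else 0 := by
      intro i j
      change (partialDeriv i (fun y => F y j) x₁).im = _
      fin_cases j <;> fin_cases i <;>
      simp only [Fin.mk_one, Fin.zero_eta, hp0, hp1, hWp0, hWp1, hβ, hlam, Fin.isValue,
        if_true, one_ne_zero, zero_ne_one, if_false] <;>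
      simp <;> linarith
    rw [ContinuousLinearMap.comp_apply, clm_apply_eq (fderiv ℝ (fun y => F y j) x₁) y]
    simp only [Complex.imCLM_apply, Complex.add_im, Complex.smul_im, hp, smul_apply]
    fin_cases j <;> simp [mul_comm]
  obtain ⟨ρ, hρ, hρR, hquad⟩ := exists_quadratic_bounds hR (by rw [hlam]; positivity) hf0 hfd
    hF00 hF'
  refine ⟨w, hws, ?_, hwS, f, hfs, fun y hy j => ?_, ρ, hρ, hρR, lam, by rw [hlam]; positivity,
    hquad⟩
  · rw [hw0, hα]
    refine mul_ne_zero two_ne_zero fun h => ?_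
    have hre := congrArg Complex.re h
    have him := congrArg Complex.im h
    simp at hre him
    obtain ⟨j, hj⟩ := hne
    fin_cases j
    · exact hj him
    · exact hj hre
  · rw [(hfd y hy).partialDeriv, linForm_basisVec]

/-! ### Norms and supports -/

theorem sqrt_volume_closedBall (x : Plane) {s : ℝ} (hs : 0 ≤ s) :
    √((volume : Measure Plane).real (Metric.closedBall x s)) =
      s * √((volume : Measure Plane).real (Metric.ball (0 : Plane) 1)) := by
  rw [Measure.addHaar_real_closedBall _ _ hs, finrank_euclideanSpace_fin,
    Real.sqrt_mul (by positivity), Real.sqrt_sq hs]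

theorem sqrt_volume_unitBall_pos :
    0 < √((volume : Measure Plane).real (Metric.ball (0 : Plane) 1)) := by
  apply Real.sqrt_pos.2
  exact ENNReal.toReal_pos (Metric.measure_ball_pos volume _ one_pos).ne' measure_ball_lt_top.ne

theorem toReal_eLpNorm_indicator_closedBall (x : Plane) {s b : ℝ} (hs : 0 ≤ s) (hb : 0 ≤ b) :
    (eLpNorm ((Metric.closedBall x s).indicator fun _ => b) 2 (volume : Measure Plane)).toReal =
      b * (s * √((volume : Measure Plane).real (Metric.ball (0 : Plane) 1))) := by
  rw [eLpNorm_indicator_const Metric.isClosed_closedBall.measurableSet two_ne_zero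
    ENNReal.ofNat_ne_top, ENNReal.toReal_mul, ← ENNReal.toReal_rpow, toReal_enorm,
    Real.norm_of_nonneg hb, ← sqrt_volume_closedBall x hs, Real.sqrt_eq_rpow]
  simp [Measure.real]

theorem eLpNorm_indicator_closedBall_ne_top (x : Plane) (s b : ℝ) :
    eLpNorm ((Metric.closedBall x s).indicator fun _ => b) 2 (volume : Measure Plane) ≠ ⊤ := by
  rw [eLpNorm_indicator_const Metric.isClosed_closedBall.measurableSet two_ne_zero
    ENNReal.ofNat_ne_top]
  exact ENNReal.mul_ne_top enorm_ne_top
    (ENNReal.rpow_ne_top_of_nonneg (by simp) measure_closedBall_lt_top.ne)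

theorem IsTestFunction.norm_toL2_le {g : Plane → ℂ} (hg : IsTestFunction g) {x : Plane} {s b : ℝ}
    (hs : 0 ≤ s) (hb : 0 ≤ b) (hgb : ∀ y ∈ Metric.closedBall x s, ‖g y‖ ≤ b)
    (hg0 : ∀ y ∉ Metric.closedBall x s, g y = 0) :
    ‖hg.toL2‖ ≤ b * (s * √((volume : Measure Plane).real (Metric.ball (0 : Plane) 1))) := by
  rw [← toReal_eLpNorm_indicator_closedBall x hs hb, IsTestFunction.toL2, Lp.norm_toLp]
  refine ENNReal.toReal_mono (eLpNorm_indicator_closedBall_ne_top x s b) (eLpNorm_mono fun y => ?_)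
  by_cases hy : y ∈ Metric.closedBall x s
  · rw [indicator_of_mem hy, Real.norm_of_nonneg hb]
    exact hgb y hy
  · rw [indicator_of_notMem hy, hg0 y hy, norm_zero, norm_zero]

theorem IsTestFunction.le_norm_toL2 {g : Plane → ℂ} (hg : IsTestFunction g) {x : Plane} {s b : ℝ}
    (hs : 0 ≤ s) (hb : 0 ≤ b) (hgb : ∀ y ∈ Metric.closedBall x s, b ≤ ‖g y‖) :
    b * (s * √((volume : Measure Plane).real (Metric.ball (0 : Plane) 1))) ≤ ‖hg.toL2‖ := by
  rw [← toReal_eLpNorm_indicator_closedBall x hs hb, IsTestFunction.toL2, Lp.norm_toLp]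
  refine ENNReal.toReal_mono hg.memLp.eLpNorm_ne_top (eLpNorm_mono fun y => ?_)
  by_cases hy : y ∈ Metric.closedBall x s
  · rw [indicator_of_mem hy, Real.norm_of_nonneg hb]
    exact hgb y hy
  · rw [indicator_of_notMem hy, norm_zero]
    exact norm_nonneg _

theorem classicalLaplacian_eq_zero {h : ℝ} {A : Plane → Fin 2 → ℂ} {u : Plane → ℂ} {x : Plane}
    (hx : x ∉ tsupport u) : classicalLaplacian h A u x = 0 := by
  have hm : ∀ {g : Plane → ℂ} (j : Fin 2), g =ᶠ[nhds x] 0 → momentum h A j g =ᶠ[nhds x] 0 := by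
    intro g j hg
    filter_upwards [hg.eventuallyEq_nhds] with y hy
    rw [momentum_congr hy, momentum]
    have h0 : HasFDerivAt (0 : Plane → ℂ) (0 : Plane →L[ℝ] ℂ) y := hasFDerivAt_const 0 y
    rw [h0.partialDeriv]
    simp
  have h0 := notMem_tsupport_iff_eventuallyEq.1 hx
  rw [classicalLaplacian]
  exact Finset.sum_eq_zero fun j _ => (hm j (hm j h0)).eq_of_nhds

/-- The product of a bump function with a function which is smooth near its support. -/
theorem isTestFunction_bump_mul {x₁ : Plane} (χ : ContDiffBump x₁) {R : ℝ} (hR : χ.rOut < R)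
    {g : Plane → ℂ} (hg : ContDiffOn ℝ ∞ g (Metric.ball x₁ R)) :
    IsTestFunction fun x => (χ x : ℂ) * g x := by
  have hsupp : tsupport (fun x => (χ x : ℂ) * g x) ⊆ Metric.closedBall x₁ χ.rOut := by
    rw [← χ.tsupport_eq]
    refine closure_mono fun x hx => ?_
    rw [Function.mem_support] at hx ⊢
    intro h0
    exact hx (by simp [h0])
  have hχ : ContDiff ℝ ∞ fun x => (χ x : ℂ) := Complex.ofRealCLM.contDiff.comp χ.contDiff
  refine ⟨contDiff_iff_contDiffAt.2 fun x => ?_,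
    HasCompactSupport.intro' (isCompact_closedBall x₁ χ.rOut) Metric.isClosed_closedBall
      fun x hx => image_eq_zero_of_notMem_tsupport (f := fun x => (χ x : ℂ) * g x)
        fun h => hx (hsupp h)⟩
  by_cases hx : x ∈ Metric.ball x₁ R
  · exact hχ.contDiffAt.mul (hg.contDiffAt (Metric.isOpen_ball.mem_nhds hx))
  · have h0 := notMem_tsupport_iff_eventuallyEq.1 fun h =>
      hx (Metric.closedBall_subset_ball hR (hsupp h))
    exact contDiffAt_const.congr_of_eventuallyEq h0

/-! ### The quasimode -/

section

variable {h : ℝ} {x₁ : Plane} {ρ : ℝ}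

theorem norm_cutoffError_le {w v χ : Plane → ℂ} {x : Plane} {M W K : ℝ} (hh : 0 ≤ h) (hh1 : h ≤ 1)
    (hM1 : ∀ j, ‖partialDeriv j χ x‖ ≤ M) (hM2 : ∀ j, ‖partialDeriv j (partialDeriv j χ) x‖ ≤ M)
    (hW : ‖w x‖ ≤ W) (hv : ‖v x‖ ≤ 2) (hv' : ∀ j, ‖partialDeriv j v x‖ ≤ K) :
    ‖cutoffError h w v χ x‖ ≤ 4 * M * K + 4 * M + 4 * W * M := by
  have hM0 : 0 ≤ M := (norm_nonneg _).trans (hM1 0)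
  have hW0 : 0 ≤ W := (norm_nonneg _).trans hW
  have hK0 : 0 ≤ K := (norm_nonneg _).trans (hv' 0)
  have hhn : ‖(h : ℂ)‖ ≤ 1 := by rwa [Complex.norm_real, Real.norm_of_nonneg hh]
  have e1 : ‖2 * (partialDeriv 0 χ x * partialDeriv 0 v x +
      partialDeriv 1 χ x * partialDeriv 1 v x) +
      (partialDeriv 0 (partialDeriv 0 χ) x + partialDeriv 1 (partialDeriv 1 χ) x) * v x‖ ≤
      4 * M * K + 4 * M := by
    calc _ ≤ 2 * (M * K + M * K) + (M + M) * 2 := by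
          refine (norm_add_le _ _).trans (add_le_add ?_ ?_)
          · rw [norm_mul, Complex.norm_ofNat]
            refine mul_le_mul_of_nonneg_left ((norm_add_le _ _).trans (add_le_add ?_ ?_))
              zero_le_two
            · rw [norm_mul]
              exact mul_le_mul (hM1 0) (hv' 0) (norm_nonneg _) hM0
            · rw [norm_mul]
              exact mul_le_mul (hM1 1) (hv' 1) (norm_nonneg _) hM0
          · rw [norm_mul]
            exact mul_le_mul ((norm_add_le _ _).trans (add_le_add (hM2 0) (hM2 1))) hv
              (norm_nonneg _) (by positivity)
      _ = _ := by ring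
  have e2 : ‖partialDeriv 0 χ x + Complex.I * partialDeriv 1 χ x‖ ≤ 2 * M := by
    refine (norm_add_le _ _).trans ?_
    rw [norm_mul, Complex.norm_I, one_mul]
    linarith [hM1 0, hM1 1]
  rw [cutoffError]
  refine (norm_add_le _ _).trans (add_le_add ?_ ?_)
  · rw [norm_mul, norm_neg, norm_pow]
    calc ‖(h : ℂ)‖ ^ 2 * _ ≤ 1 * (4 * M * K + 4 * M) :=
          mul_le_mul (pow_le_one₀ (norm_nonneg _) hhn) e1 (norm_nonneg _) zero_le_one
      _ = _ := one_mul _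
  · rw [norm_mul, norm_mul, norm_mul, norm_mul, Complex.norm_I, one_mul]
    calc ‖(h : ℂ)‖ * ‖w x‖ * ‖v x‖ * _ ≤ 1 * W * 2 * (2 * M) := by gcongr
      _ = _ := by ring

theorem norm_exp_phase {f : Plane → ℂ} (x : Plane) :
    ‖Complex.exp (Complex.I * f x / h)‖ = Real.exp (-(f x).im / h) := by
  rw [Complex.norm_exp]
  congr 1
  rw [Complex.div_ofReal_re]
  simp

/-- Pointwise bound for `(ℒ - hμ) u`: where the cutoff is constant the amplitude equation is used,
elsewhere the decay of `e^{if/h}`. -/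
theorem norm_classicalLaplacian_sub_le {A : Plane → Fin 2 → ℂ} {μ : ℂ} (hh : 0 < h) (hh1 : h ≤ 1)
    {f : Plane → ℂ} {w v G : ℂ × ℂ → ℂ} (χ : ContDiffBump x₁) (hχρ : χ.rOut < ρ)
    (hw : ContDiffOn ℂ ∞ w (Metric.ball 0 ρ)) (hv : ContDiffOn ℂ ∞ v (Metric.ball 0 ρ))
    (hf : ContDiffOn ℝ ∞ f (Metric.ball x₁ ρ))
    (hfq : ∀ y ∈ Metric.ball x₁ ρ, ∀ j, partialDeriv j f y =
      A y j - isotropicPotential (fun y => w (diagEmb (y - x₁))) y j)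
    (hwG : ∀ p ∈ Metric.ball (0 : ℂ × ℂ) ρ, Complex.I * dSnd w p = G p)
    {a : ℝ} (ha : 0 ≤ a) (hfa : ∀ x ∈ Metric.ball x₁ ρ, a * ‖x - x₁‖ ^ 2 ≤ (f x).im)
    {M W K c : ℝ}
    (hM1 : ∀ x j, ‖partialDeriv j (fun y => (χ y : ℂ)) x‖ ≤ M)
    (hM2 : ∀ x j, ‖partialDeriv j (partialDeriv j fun y => (χ y : ℂ)) x‖ ≤ M)
    (hW : ∀ p ∈ Metric.closedBall (0 : ℂ × ℂ) χ.rOut, ‖w p‖ ≤ W)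
    (hvb : ∀ p ∈ Metric.ball (0 : ℂ × ℂ) ρ, ‖v p - 1‖ ≤ 1 / 2 ∧ ‖dFst v p‖ ≤ K ∧ ‖dSnd v p‖ ≤ K ∧
      ‖-4 * h * dFst (dSnd v) p + 2 * Complex.I * w p * dSnd v p + (G p - μ) * v p‖ ≤
        K * Real.exp (-c / h)) {x : Plane} (hx : x ∈ Metric.closedBall x₁ χ.rOut) :
    ‖classicalLaplacian h A (fun y => Complex.exp (Complex.I * f y / h) *
        ((χ y : ℂ) * v (diagEmb (y - x₁)))) x -
      h * μ * (Complex.exp (Complex.I * f x / h) * ((χ x : ℂ) * v (diagEmb (x - x₁))))‖ ≤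
      K * Real.exp (-c / h) +
        (4 * M * (2 * K) + 4 * M + 4 * W * M) * Real.exp (-(a * χ.rIn ^ 2) / h) := by
  have hχ : ContDiff ℝ ∞ fun x => (χ x : ℂ) := Complex.ofRealCLM.contDiff.comp χ.contDiff
  have hxρ : x ∈ Metric.ball x₁ ρ := Metric.closedBall_subset_ball hχρ hx
  have hp := diagEmb_sub_mem_ball hxρ
  obtain ⟨b1, b2, b3, b4⟩ := hvb _ hp
  have hK0 : 0 ≤ K := (norm_nonneg _).trans b2
  have hM0 : 0 ≤ M := (norm_nonneg _).trans (hM1 x 0)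
  have hW0 : 0 ≤ W := (norm_nonneg _).trans
    (hW 0 (Metric.mem_closedBall_self χ.rOut_pos.le))
  rw [classicalLaplacian_wkb hh.ne' hw hv hf hχ hfq hxρ, hwG _ hp]
  set E := Complex.exp (Complex.I * f x / h) with hE
  set p := diagEmb (x - x₁) with hp_def
  set S := -4 * h * dFst (dSnd v) p + 2 * Complex.I * w p * dSnd v p + (G p - μ) * v p with hS
  set T := cutoffError h (fun y => w (diagEmb (y - x₁))) (fun y => v (diagEmb (y - x₁)))
    (fun y => (χ y : ℂ)) x with hT
  have heq : E * ((χ x : ℂ) * (h * (-4 * h * dFst (dSnd v) p + 2 * Complex.I * w p * dSnd v p +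
      G p * v p)) + T) - h * μ * (E * ((χ x : ℂ) * v p)) = E * ((χ x : ℂ) * (h * S)) + E * T := by
    rw [hS]; ring
  rw [heq]
  have hfx := hfa x hxρ
  have hE1 : ‖E‖ ≤ 1 := by
    rw [hE, norm_exp_phase]
    apply Real.exp_le_one_iff.2
    apply div_nonpos_of_nonpos_of_nonneg _ hh.le
    have : 0 ≤ a * ‖x - x₁‖ ^ 2 := by positivity
    linarith
  have hχ1 : ‖(χ x : ℂ)‖ ≤ 1 := by
    rw [Complex.norm_real, Real.norm_of_nonneg χ.nonneg]
    exact χ.le_one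
  have hhn : ‖(h : ℂ)‖ ≤ 1 := by rwa [Complex.norm_real, Real.norm_of_nonneg hh.le]
  refine (norm_add_le _ _).trans (add_le_add ?_ ?_)
  · rw [norm_mul, norm_mul, norm_mul]
    calc ‖E‖ * (‖(χ x : ℂ)‖ * (‖(h : ℂ)‖ * ‖S‖)) ≤ 1 * (1 * (1 * (K * Real.exp (-c / h)))) := by
          gcongr
      _ = _ := by ring
  · by_cases hin : x ∈ Metric.ball x₁ χ.rIn
    · have hev : (fun y => (χ y : ℂ)) =ᶠ[nhds x] fun _ => 1 := by
        filter_upwards [χ.eventuallyEq_one_of_mem_ball hin] with y hy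
        simp [hy]
      have hpc : ∀ (j : Fin 2) (y : Plane) (z : ℂ), partialDeriv j (fun _ => z) y = 0 := by
        intro j y z
        rw [(hasFDerivAt_const z y).partialDeriv]
        simp
      have d1 : ∀ j, partialDeriv j (fun y => (χ y : ℂ)) =ᶠ[nhds x] fun _ => 0 := by
        intro j
        filter_upwards [hev.eventuallyEq_nhds] with y hy
        rw [partialDeriv_congr hy, hpc]
      have hT0 : T = 0 := by
        rw [hT, cutoffError, (d1 0).eq_of_nhds, (d1 1).eq_of_nhds, partialDeriv_congr (d1 0),
          partialDeriv_congr (d1 1), hpc, hpc]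
        ring
      rw [hT0, mul_zero, norm_zero]
      positivity
    · have hE2 : ‖E‖ ≤ Real.exp (-(a * χ.rIn ^ 2) / h) := by
        rw [hE, norm_exp_phase]
        apply Real.exp_le_exp.2
        gcongr
        refine le_trans ?_ hfx
        rw [Metric.mem_ball, dist_eq_norm, not_lt] at hin
        have := χ.rIn_pos
        gcongr
      have hv2 : ‖v p‖ ≤ 2 := by
        have h2 := norm_add_le (v p - 1) 1
        rw [sub_add_cancel, norm_one] at h2
        linarith
      have hpW : p ∈ Metric.closedBall (0 : ℂ × ℂ) χ.rOut := by
        rw [mem_closedBall_zero_iff, hp_def, norm_diagEmb, ← dist_eq_norm]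
        exact hx
      have hvd := hv.differentiableAt_ball hp
      have hv' : ∀ j, ‖partialDeriv j (fun y => v (diagEmb (y - x₁))) x‖ ≤ 2 * K := by
        intro j
        fin_cases j
        · change ‖partialDeriv 0 (fun y => v (diagEmb (y - x₁))) x‖ ≤ 2 * K
          rw [partialDeriv_zero_comp_diagEmb hvd]
          refine (norm_add_le _ _).trans ?_
          linarith
        · change ‖partialDeriv 1 (fun y => v (diagEmb (y - x₁))) x‖ ≤ 2 * K
          rw [partialDeriv_one_comp_diagEmb hvd, norm_mul, Complex.norm_I, one_mul]
          refine (norm_sub_le _ _).trans ?_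
          linarith
      have hTb : ‖T‖ ≤ 4 * M * (2 * K) + 4 * M + 4 * W * M :=
        norm_cutoffError_le hh.le hh1 (hM1 x) (hM2 x) (hW p hpW) hv2 hv'
      rw [norm_mul, mul_comm]
      exact mul_le_mul hTb hE2 (norm_nonneg _) (by positivity)

end

theorem exists_bound_partialDeriv {φ : Plane → ℂ} (hφ : IsTestFunction φ) :
    ∃ M, ∀ x j, ‖partialDeriv j φ x‖ ≤ M := by
  choose C hC using fun j : Fin 2 =>
    (hφ.partialDeriv j).2.exists_bound_of_continuous (hφ.partialDeriv j).1.continuous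
  refine ⟨max (C 0) (C 1), fun x j => ?_⟩
  fin_cases j
  · exact (hC 0 x).trans (le_max_left _ _)
  · exact (hC 1 x).trans (le_max_right _ _)

/-- At a point where `Im A ≠ 0` and `Re B + div Im A > 0`, and near which `B` is real-analytic,
every `hμ` is an approximate eigenvalue up to an error which is exponentially small
in `1 / h`. -/
theorem exists_quasimode {A : Plane → Fin 2 → ℂ} (hA : ContDiff ℝ ∞ A) {x₁ : Plane}
    (hne : ∃ j, (A x₁ j).im ≠ 0)
    (hpos : 0 < (magneticField A x₁).re + partialDeriv 0 (fun y => (A y 0).im) x₁ +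
      partialDeriv 1 (fun y => (A y 1).im) x₁)
    (hB : AnalyticAt ℝ (magneticField A) x₁) (μ : ℂ) :
    ∃ c > (0 : ℝ), ∃ K > (0 : ℝ), ∃ h₀ > (0 : ℝ), ∀ h ∈ Ioc 0 h₀, ∃ u : Plane → ℂ,
      u ≠ 0 ∧ ∃ hu : IsTestFunction u, hu.toL2 ∈ magneticDomain h A ∧
        ‖magneticLaplacian h A hu.toL2 - ((h : ℂ) * μ) • hu.toL2‖ ≤
          K / h * Real.exp (-c / h) * ‖hu.toL2‖ := by
  obtain ⟨R, hR, G, hG, hBG⟩ := hB.exists_complexification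
  obtain ⟨w, hw, hw0, hwG, f, hf, hfq, ρ₁, hρ₁, hρ₁R, lam, hlam, hquad⟩ :=
    exists_phase hA hne hpos hR hG hBG
  obtain ⟨ρ₂, hρ₂, hρ₂R, c, hc, K, hK, h₀, hh₀, hamp⟩ := exists_amplitude hR hw hG hw0 μ
  set ρ := min ρ₁ ρ₂ with hρ_def
  have hρ : 0 < ρ := lt_min hρ₁ hρ₂
  have hρ1 : ρ ≤ ρ₁ := min_le_left _ _
  have hρ2 : ρ ≤ ρ₂ := min_le_right _ _
  have hρR : ρ ≤ R := hρ1.trans hρ₁R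
  have hsubC : Metric.ball (0 : ℂ × ℂ) ρ ⊆ Metric.ball 0 R := Metric.ball_subset_ball hρR
  have hsubP : Metric.ball x₁ ρ ⊆ Metric.ball x₁ R := Metric.ball_subset_ball hρR
  set χ : ContDiffBump x₁ := ⟨ρ / 4, ρ / 2, by positivity, by linarith⟩ with hχ_def
  have hχin : χ.rIn = ρ / 4 := rfl
  have hχout : χ.rOut = ρ / 2 := rfl
  have hχρ : χ.rOut < ρ := by rw [hχout]; linarith
  have hχt : IsTestFunction fun x => (χ x : ℂ) := by
    simpa using isTestFunction_bump_mul χ hχρ (contDiffOn_const (c := (1 : ℂ)))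
  obtain ⟨M₁, hM₁⟩ := exists_bound_partialDeriv hχt
  obtain ⟨M₂, hM₂⟩ := exists_bound_partialDeriv (hχt.partialDeriv 0)
  obtain ⟨M₃, hM₃⟩ := exists_bound_partialDeriv (hχt.partialDeriv 1)
  set M := max M₁ (max M₂ M₃) with hM_def
  have hM1 : ∀ x j, ‖partialDeriv j (fun y => (χ y : ℂ)) x‖ ≤ M := fun x j =>
    (hM₁ x j).trans (le_max_left _ _)
  have hM2 : ∀ x j, ‖partialDeriv j (partialDeriv j fun y => (χ y : ℂ)) x‖ ≤ M := by
    intro x j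
    fin_cases j
    · exact (hM₂ x 0).trans ((le_max_left _ _).trans (le_max_right _ _))
    · exact (hM₃ x 1).trans ((le_max_right _ _).trans (le_max_right _ _))
  have hM0 : 0 ≤ M := (norm_nonneg _).trans (hM1 x₁ 0)
  obtain ⟨W, hW⟩ := (isCompact_closedBall (0 : ℂ × ℂ) χ.rOut).exists_bound_of_continuousOn
    (hw.continuousOn.mono ((Metric.closedBall_subset_ball hχρ).trans hsubC))
  have hW0 : 0 ≤ W := (norm_nonneg _).trans (hW 0 (Metric.mem_closedBall_self χ.rOut_pos.le))
  set D := √((volume : Measure Plane).real (Metric.ball (0 : Plane) 1)) with hD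
  have hDpos : 0 < D := sqrt_volume_unitBall_pos
  set K' := K + (4 * M * (2 * K) + 4 * M + 4 * W * M) with hK'
  have hK'pos : 0 < K' := by positivity
  set c' := min c (lam / 4 * χ.rIn ^ 2) with hc'
  have hc'pos : 0 < c' := lt_min hc (by have := χ.rIn_pos; positivity)
  refine ⟨c', hc'pos, K' * ρ * Real.exp lam, by positivity, min h₀ (min 1 (ρ / 8)),
    lt_min hh₀ (lt_min one_pos (by positivity)), fun h hh => ?_⟩
  have hh0 : 0 < h := hh.1
  have hhh₀ : h ≤ h₀ := hh.2.trans (min_le_left _ _)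
  have hh1 : h ≤ 1 := hh.2.trans ((min_le_right _ _).trans (min_le_left _ _))
  have hhρ : h ≤ ρ / 8 := hh.2.trans ((min_le_right _ _).trans (min_le_right _ _))
  obtain ⟨v, hvs, hvb⟩ := hamp h hh0 hhh₀
  have hvs' : ContDiffOn ℂ ∞ v (Metric.ball 0 ρ) := hvs.mono (Metric.ball_subset_ball hρ2)
  have hvb' := fun p (hp : p ∈ Metric.ball (0 : ℂ × ℂ) ρ) => hvb p (Metric.ball_subset_ball hρ2 hp)
  set u : Plane → ℂ := fun y => Complex.exp (Complex.I * f y / h) *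
    ((χ y : ℂ) * v (diagEmb (y - x₁))) with hu_def
  have hu : IsTestFunction u := by
    have h1 : ContDiffOn ℝ ∞ (fun y => Complex.exp (Complex.I * f y / h) * v (diagEmb (y - x₁)))
        (Metric.ball x₁ ρ) :=
      (((contDiffOn_const.mul (hf.mono hsubP)).div_const _).cexp).mul
        (contDiffOn_comp_diagEmb hvs')
    have h2 := isTestFunction_bump_mul χ hχρ h1
    have h3 : u = fun y => (χ y : ℂ) *
        (Complex.exp (Complex.I * f y / h) * v (diagEmb (y - x₁))) := by
      funext y; rw [hu_def]; ring
    rwa [h3]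
  -- on the disc of radius `h`, `Im f ≤ λ h`
  have hlow : ∀ y ∈ Metric.closedBall x₁ h, Real.exp (-lam) / 2 ≤ ‖u y‖ := by
    intro y hy
    have hyn : ‖y - x₁‖ ≤ h := by rw [← dist_eq_norm]; exact hy
    have hyρ : y ∈ Metric.ball x₁ ρ := by
      rw [Metric.mem_ball, dist_eq_norm]; linarith
    have hχ1 : χ y = 1 := χ.one_of_mem_closedBall (by
      rw [Metric.mem_closedBall, dist_eq_norm, hχin]; linarith)
    have hfy := (hquad y (Metric.ball_subset_ball hρ1 hyρ)).2
    have hv1 := (hvb' _ (diagEmb_sub_mem_ball hyρ)).1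
    have hv2 : 1 / 2 ≤ ‖v (diagEmb (y - x₁))‖ := by
      have := norm_sub_norm_le (1 : ℂ) (1 - v (diagEmb (y - x₁)))
      rw [sub_sub_cancel, norm_one, norm_sub_rev] at this
      linarith
    have hE : Real.exp (-lam) ≤ ‖Complex.exp (Complex.I * f y / h)‖ := by
      rw [norm_exp_phase]
      apply Real.exp_le_exp.2
      rw [neg_div, neg_le_neg_iff, div_le_iff₀ hh0]
      calc (f y).im ≤ lam * ‖y - x₁‖ ^ 2 := hfy
        _ ≤ lam * h ^ 2 := by gcongr
        _ ≤ lam * h := by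
          gcongr
          nlinarith
    rw [hu_def]
    simp only [hχ1, Complex.ofReal_one, one_mul, norm_mul]
    calc Real.exp (-lam) / 2 = Real.exp (-lam) * (1 / 2) := by ring
      _ ≤ _ := mul_le_mul hE hv2 (by norm_num) (norm_nonneg _)
  have hnorm_low : Real.exp (-lam) / 2 * (h * D) ≤ ‖hu.toL2‖ :=
    hu.le_norm_toL2 hh0.le (by positivity) hlow
  have hL := isMagneticLaplacian_toL2 h hA hu
  refine ⟨u, fun h0 => ?_, hu, ⟨_, hL⟩, ?_⟩
  · have := hlow x₁ (Metric.mem_closedBall_self hh0.le)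
    rw [h0, Pi.zero_apply, norm_zero] at this
    have := Real.exp_pos (-lam)
    linarith
  · rw [magneticLaplacian_eq hA.continuous hL]
    have hg : IsTestFunction fun x => classicalLaplacian h A u x - h * μ * u x :=
      (hu.classicalLaplacian h hA).sub (hu.smooth_mul contDiff_const)
    have hgeq : (hu.classicalLaplacian h hA).toL2 - ((h : ℂ) * μ) • hu.toL2 = hg.toL2 := by
      rw [IsTestFunction.toL2, IsTestFunction.toL2, IsTestFunction.toL2,
        ← MemLp.toLp_const_smul, ← MemLp.toLp_sub]
      rfl
    have hsupp : ∀ y ∉ Metric.closedBall x₁ χ.rOut, y ∉ tsupport u := by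
      intro y hy hyt
      refine hy ?_
      rw [← χ.tsupport_eq]
      refine closure_mono (fun x hx => ?_) hyt
      rw [Function.mem_support] at hx ⊢
      intro h0
      exact hx (by rw [hu_def]; simp [h0])
    have hup : ‖hg.toL2‖ ≤ (K' * Real.exp (-c' / h)) * (χ.rOut * D) := by
      refine hg.norm_toL2_le (x := x₁) χ.rOut_pos.le (by positivity) (fun y hy => ?_)
        fun y hy => ?_
      · have := norm_classicalLaplacian_sub_le hh0 hh1 χ hχρ (hw.mono hsubC) hvs' (hf.mono hsubP)
          (fun y hy => hfq y (hsubP hy)) (fun p hp => hwG p (hsubC hp)) (by positivity)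
          (fun x hx => (hquad x (Metric.ball_subset_ball hρ1 hx)).1) hM1 hM2 hW hvb' hy
        refine this.trans ?_
        have e : K' * Real.exp (-c' / h) = K * Real.exp (-c' / h) +
            (4 * M * (2 * K) + 4 * M + 4 * W * M) * Real.exp (-c' / h) := by
          rw [hK', add_mul]
        rw [e]
        gcongr
        · exact min_le_left _ _
        · exact min_le_right _ _
      · rw [classicalLaplacian_eq_zero (hsupp y hy),
          image_eq_zero_of_notMem_tsupport (hsupp y hy)]
        simp
    rw [hgeq]
    refine hup.trans ?_
    calc K' * Real.exp (-c' / h) * (χ.rOut * D)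
        = K' * ρ * Real.exp lam / h * Real.exp (-c' / h) * (Real.exp (-lam) / 2 * (h * D)) := by
          rw [hχout, Real.exp_neg lam]
          field_simp
      _ ≤ _ := by gcongr

/-! ### The set `Γ` -/

theorem contDiff_partialDeriv {F : Type*} [NormedAddCommGroup F] [NormedSpace ℝ F]
    {g : Plane → F} (hg : ContDiff ℝ ∞ g) (j : Fin 2) : ContDiff ℝ ∞ (partialDeriv j g) :=
  (hg.fderiv_right (by simp)).clm_apply contDiff_const

theorem contDiff_magneticField {A : Plane → Fin 2 → ℂ} (hA : ContDiff ℝ ∞ A) :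
    ContDiff ℝ ∞ (magneticField A) :=
  (contDiff_partialDeriv (contDiff_component hA 1) 0).sub
    (contDiff_partialDeriv (contDiff_component hA 0) 1)

theorem partialDeriv_im_eq_zero {g : Plane → ℂ} (hg : ContDiff ℝ ∞ g) {x : Plane}
    (h0 : ∀ᶠ y in nhds x, (g y).im = 0) (j : Fin 2) : (partialDeriv j g x).im = 0 := by
  rw [← partialDeriv_im (hg.differentiable (by simp) x)]
  have hev : (fun y => (g y).im) =ᶠ[nhds x] fun _ => 0 := h0
  rw [partialDeriv, hev.fderiv_eq]
  simp

/-- Near a point where `Im A` vanishes identically, `B` is real, hence `|∂_z B| = |∂_{z̄} B|` and the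
quadratic form is degenerate. -/
theorem formQ_discriminant_eq_zero {A : Plane → Fin 2 → ℂ} (hA : ContDiff ℝ ∞ A) {x : Plane}
    (h0 : ∀ᶠ y in nhds x, ∀ j, (A y j).im = 0) (hne : wirtingerBar (magneticField A) x ≠ 0) :
    formQ1 A x * formQ3 A x - formQ2 A x ^ 2 = 0 := by
  have hAj : ∀ j, ∀ᶠ y in nhds x, (A y j).im = 0 := fun j => h0.mono fun y hy => hy j
  have hd : ∀ i j, partialDeriv i (fun y => (A y j).im) x = 0 := by
    intro i j
    rw [partialDeriv_im ((contDiff_component hA j).differentiable (by simp) x)]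
    exact partialDeriv_im_eq_zero (contDiff_component hA j) (hAj j) i
  have hBim : ∀ᶠ y in nhds x, (magneticField A y).im = 0 := by
    filter_upwards [(hAj 0).eventually_nhds, (hAj 1).eventually_nhds] with y hy0 hy1
    rw [magneticField, Complex.sub_im, partialDeriv_im_eq_zero (contDiff_component hA 1) hy1,
      partialDeriv_im_eq_zero (contDiff_component hA 0) hy0, sub_zero]
  have hBp := partialDeriv_im_eq_zero (contDiff_magneticField hA) hBim
  have hB0 := hBim.self_of_nhds
  set b := magneticField A x with hb
  set p := partialDeriv 0 (magneticField A) x with hp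
  set q := partialDeriv 1 (magneticField A) x with hq
  have hratio : Complex.normSq (fieldRatio A x) = 1 := by
    rw [fieldRatio, Complex.normSq_div]
    have e : Complex.normSq (wirtinger (magneticField A) x) =
        Complex.normSq (wirtingerBar (magneticField A) x) := by
      have h0 := hBp 0
      have h1 := hBp 1
      rw [← hp] at h0
      rw [← hq] at h1
      rw [wirtinger, wirtingerBar, ← hp, ← hq, Complex.normSq_mul, Complex.normSq_mul,
        Complex.normSq_apply (p - _), Complex.normSq_apply (p + _)]
      simp [h0, h1]
    rw [e, div_self]
    exact (Complex.normSq_pos.2 hne).ne'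
  rw [Complex.normSq_apply] at hratio
  rw [formQ1, formQ2, formQ3, hd, hd, hd, hd, ← hb]
  simp only [Complex.mul_re, Complex.mul_im, Complex.add_re, Complex.add_im, Complex.sub_re,
    Complex.sub_im, Complex.one_re, Complex.one_im, hB0]
  linear_combination (-(1 / 16) * b.re ^ 2) * hratio

/-- The trace of the quadratic form defining `Γ` is positive. -/
theorem trace_pos_of_mem_gammaSet {A : Plane → Fin 2 → ℂ} {x : Plane} (hx : x ∈ gammaSet A) :
    0 < (magneticField A x).re + partialDeriv 0 (fun y => (A y 0).im) x +
      partialDeriv 1 (fun y => (A y 1).im) x := by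
  obtain ⟨-, -, -, h1, h2⟩ := hx
  have h3 : 0 < formQ3 A x := by
    have : 0 < formQ1 A x * formQ3 A x := by nlinarith [sq_nonneg (formQ2 A x)]
    exact (mul_pos_iff_of_pos_left h1).1 this
  have h4 : formQ1 A x + formQ3 A x = 1 / 2 * ((magneticField A x).re +
      partialDeriv 0 (fun y => (A y 0).im) x + partialDeriv 1 (fun y => (A y 1).im) x) := by
    rw [formQ1, formQ3, mul_add, mul_sub, Complex.add_re, Complex.sub_re, mul_one]
    ring
  linarith

theorem exists_near_mem_gammaSet {A : Plane → Fin 2 → ℂ} (hA : ContDiff ℝ ∞ A) {x₀ : Plane}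
    (hx₀ : x₀ ∈ gammaSet A) (hB : AnalyticAt ℝ (magneticField A) x₀) :
    ∃ x₁, (∃ j, (A x₁ j).im ≠ 0) ∧
      0 < (magneticField A x₁).re + partialDeriv 0 (fun y => (A y 0).im) x₁ +
        partialDeriv 1 (fun y => (A y 1).im) x₁ ∧ AnalyticAt ℝ (magneticField A) x₁ := by
  have him : ∀ j, ContDiff ℝ ∞ fun y => (A y j).im := fun j =>
    Complex.imCLM.contDiff.comp (contDiff_component hA j)
  have hcont : Continuous fun x => (magneticField A x).re +
      partialDeriv 0 (fun y => (A y 0).im) x + partialDeriv 1 (fun y => (A y 1).im) x :=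
    ((Complex.continuous_re.comp (contDiff_magneticField hA).continuous).add
      (contDiff_partialDeriv (him 0) 0).continuous).add
      (contDiff_partialDeriv (him 1) 1).continuous
  have hfreq : ∃ᶠ y in nhds x₀, ∃ j, (A y j).im ≠ 0 := by
    intro hn
    have h0 : ∀ᶠ y in nhds x₀, ∀ j, (A y j).im = 0 := hn.mono fun y hy j => by
      by_contra hj
      exact hy ⟨j, hj⟩
    exact hx₀.2.2.2.2.ne' (formQ_discriminant_eq_zero hA h0 hx₀.2.2.1)
  obtain ⟨x₁, h1, h2, h3⟩ := (hfreq.and_eventually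
    ((hcont.continuousAt.eventually (lt_mem_nhds (trace_pos_of_mem_gammaSet hx₀))).and
      hB.eventually_analyticAt)).exists
  exact ⟨x₁, h1, h2, h3⟩

/-- Polynomial factors in `1 / h` are absorbed in the exponential. -/
theorem mul_exp_le_exp {c K h : ℝ} (hc : 0 < c) (hK : 0 < K) (hh : 0 < h) (hh1 : h ≤ 1)
    (hhK : h ≤ c ^ 2 / (8 * K)) :
    K / h * Real.exp (-c / h) ≤ Real.exp (-(c / 2) / h ^ (1 / 7 : ℝ)) := by
  have h1 : K / h ≤ Real.exp (c / 2 / h) := by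
    have h2 := Real.quadratic_le_exp_of_nonneg (x := c / 2 / h) (by positivity)
    have h3 : K / h ≤ (c / 2 / h) ^ 2 / 2 := by
      have e : (c / 2 / h) ^ 2 / 2 = (c ^ 2 / 8 / h) / h := by field_simp; norm_num
      rw [e]
      gcongr
      rw [le_div_iff₀ hh]
      rw [le_div_iff₀ (by positivity)] at hhK
      linarith
    have h4 : 0 ≤ c / 2 / h := by positivity
    linarith
  have h5 : h ≤ h ^ (1 / 7 : ℝ) := by
    conv_lhs => rw [← Real.rpow_one h]
    exact Real.rpow_le_rpow_of_exponent_ge hh hh1 (by norm_num)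
  calc K / h * Real.exp (-c / h) ≤ Real.exp (c / 2 / h) * Real.exp (-c / h) := by gcongr
    _ = Real.exp (-(c / 2 / h)) := by
      rw [← Real.exp_add]; congr 1; ring
    _ ≤ Real.exp (-(c / 2) / h ^ (1 / 7 : ℝ)) := by
      apply Real.exp_le_exp.2
      rw [neg_div]
      apply neg_le_neg
      gcongr

theorem theorem1p9 (A : Plane → Fin 2 → ℂ) (hA : ContDiff ℝ ∞ A) :
    (∀ x₀ ∈ gammaSet A, AnalyticAt ℝ (magneticField A) x₀ →
      ∃ C > (0 : ℝ), ∃ h₀ > (0 : ℝ), ∃ u : ℝ → Plane → ℂ, ∀ h ∈ Ioc 0 h₀,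
        u h ≠ 0 ∧ ∃ hu : IsTestFunction (u h),
          hu.toL2 ∈ magneticDomain h A ∧
          ‖magneticLaplacian h A hu.toL2 - ((h : ℂ) * magneticField A x₀) • hu.toL2‖ ≤
            Real.exp (-C / h ^ (1 / 7 : ℝ)) * ‖hu.toL2‖) ∧
    ((∀ x j, (A x j).im = 0) → gammaSet A = ∅) := by
  refine ⟨fun x₀ hx₀ hB => ?_, fun him => ?_⟩
  · obtain ⟨x₁, hne, hpos, hB₁⟩ := exists_near_mem_gammaSet hA hx₀ hB
    obtain ⟨c, hc, K, hK, h₀, hh₀, hq⟩ :=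
      exists_quasimode hA hne hpos hB₁ (magneticField A x₀)
    choose! u hu0 hut hudom hule using hq
    refine ⟨c / 2, by positivity, min h₀ (min 1 (c ^ 2 / (8 * K))), by positivity, u,
      fun h hh => ?_⟩
    have hh' : h ∈ Ioc 0 h₀ := ⟨hh.1, hh.2.trans (min_le_left _ _)⟩
    refine ⟨hu0 h hh', hut h hh', hudom h hh', (hule h hh').trans ?_⟩
    gcongr
    exact mul_exp_le_exp hc hK hh.1 (hh.2.trans ((min_le_right _ _).trans (min_le_left _ _)))
      (hh.2.trans ((min_le_right _ _).trans (min_le_right _ _)))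
  · refine eq_empty_of_forall_notMem fun x hx => hx.2.2.2.2.ne' ?_
    exact formQ_discriminant_eq_zero hA (Filter.Eventually.of_forall him) hx.2.2.1
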